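/- Let $\mathcal I$ be the set of finite intervals of $\mathbb Z$ (including $\varnothing$). Let $\mathfrak M$ be a unital $C^*$-algebra and $(M_I)_{I\in\mathcal I}$ a family of $W^*$-subalgebras of $\mathfrak M$, with $M_\varnothing=\mathbb C1$, forming a quasi-local algebra: every $M_I$ contains the unit of $\mathfrak M$; $M_I\subseteq M_J$ if $I\subseteq J$; $\mathfrak M_0:=\bigcup_{I}M_I$ is dense in $\mathfrak M$; and $M_I$ commutes with $M_J$ if $I\cap J=\varnothing$. Let $\gamma\colon\mathbb Z\curvearrowright\mathfrak M$ be an action by $*$-automorphisms with $\gamma_j(M_I)=M_{I+j}$ for all $I\in\mathcal I$, $j\in\mathbb Z$, and let $\chi$ be a $\gamma$-invariant state on $\mathfrak M$ that is multiplicative, i.e. $\chi(xy)=\chi(x)\chi(y)$ whenever $x\in M_I$, $y\in M_J$ and $I\cap J=\varnothing$. Let $(I_n)_n$ be an increasing sequence in $\mathcal I$ with $\bigcup_n I_n=\mathbb Z$, and for $x\in\mathfrak M$ put $$F_n(x):=\frac1{\sqrt{|I_n|}}\sum_{j\in I_n}\bigl(\gamma_j(x)-\chi(x)1\bigr).$$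 Let $\mathfrak M_{0,\mathrm{sa}}$ be the real vector space of self-adjoint elements of $\mathfrak M_0$, with the symmetric bilinear form $s_\chi$ and the (possibly degenerate) symplectic form $\sigma_\chi$ given by $$s_\chi(x,y):=\operatorname{Re}\sum_{k\in\mathbb Z}\bigl(\chi(x\gamma_k(y))-\chi(x)\chi(y)\bigr),\qquad \sigma_\chi(x,y):=-\operatorname{Im}\sum_{k\in\mathbb Z}\bigl(\chi(x\gamma_k(y))-\chi(x)\chi(y)\bigr),$$ where only finitely many summands are nonzero. Let $\mathfrak W_\chi$ be the Weyl CCR algebra of $(\mathfrak M_{0,\mathrm{sa}},\sigma_\chi)$, that is, the universal $C^*$-algebra generated by elements $w(x)$ ($x\in\mathfrak M_{0,\mathrm{sa}}$) subject to the relations $$w(x)^*=w(-x),\qquad w(x)w(y)=e^{\mathrm i\sigma_\chi(x,y)}w(x+y).$$ Then there is a unique state $\varphi_\chi$ on $\mathfrak W_\chi$ (the quasi-free state) with $\varphi_\chi(w(x))=e^{-s_\chi(x,x)/2}$ for all $x\in\mathfrak M_{0,\mathrm{sa}}$, and for all $k\in\mathbb N$ and $x_1,\dots,x_k\in\mathfrak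 M_{0,\mathrm{sa}}$, $$\lim_{n\to\infty}\chi\bigl(e^{\mathrm iF_n(x_1)}\cdots e^{\mathrm iF_n(x_k)}\bigr)=\varphi_\chi\bigl(w(x_1)\cdots w(x_k)\bigr).$$ -/

import Mathlib

noncomputable section

/-! ### States -/

open scoped ComplexOrder in
/-- A state on a unital `*`-algebra (in particular on a unital C*-algebra): a positive linear
functional that is normalised at the unit. -/
structure IsState {A : Type*} [Ring A] [StarRing A] [Algebra ℂ A] (φ : A →ₗ[ℂ] ℂ) : Prop where
  map_one : φ 1 = 1
  nonneg : ∀ a : A, 0 ≤ φ (star a * a)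

theorem IsState.map_star {A : Type*} [Ring A] [StarRing A] [Algebra ℂ A] [StarModule ℂ A]
    {φ : A →ₗ[ℂ] ℂ} (h : IsState φ) (a : A) : φ (star a) = star (φ a) := by
  have key : ∀ b : A, (φ b + φ (star b)).im = 0 := by
    intro b
    have h1 := (Complex.nonneg_iff.1 (h.nonneg (1 + b))).2
    have h2 := (Complex.nonneg_iff.1 (h.nonneg b)).2
    have e : star (1 + b) * (1 + b) = 1 + (b + star b) + star b * b := by
      rw [star_add, star_one]; noncomm_ring
    rw [e, map_add, map_add, map_add, h.map_one] at h1
    simp only [Complex.add_im, Complex.one_im] at h1 ⊢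
    linarith
  have h1 := key a
  have h2 := key (Complex.I • a)
  rw [star_smul, map_smul, map_smul] at h2
  simp only [Complex.add_im, smul_eq_mul, Complex.mul_im, Complex.I_re, Complex.I_im,
    Complex.star_def, Complex.conj_I, Complex.neg_re, Complex.neg_im] at h1 h2
  apply Complex.ext
  · simp only [Complex.star_def, Complex.conj_re]; linarith
  · simp only [Complex.star_def, Complex.conj_im]; linarith

/-! ### Finite intervals of `ℤ` -/

/-- The finite intervals of `ℤ` (the empty one included), ordered by inclusion. -/
abbrev FinInterval : Type := {I : Finset ℤ // (I : Set ℤ).OrdConnected}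

namespace FinInterval

/-- The empty interval. -/
def empty : FinInterval := ⟨∅, by simpa using Set.ordConnected_empty⟩

/-- The translate `I + j = {n | n - j ∈ I}`. -/
def shift (I : FinInterval) (j : ℤ) : FinInterval :=
  ⟨I.1.image (fun i => i + j), by
    constructor
    intro a ha b hb c hc
    simp only [Finset.coe_image, Set.mem_image, Finset.mem_coe] at ha hb ⊢
    obtain ⟨a', ha', rfl⟩ := ha
    obtain ⟨b', hb', rfl⟩ := hb
    refine ⟨c - j, I.2.out ha' hb' ⟨?_, ?_⟩, by ring⟩ <;> have := hc.1 <;> have := hc.2 <;>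
      omega⟩

theorem directed (I J : FinInterval) : ∃ K : FinInterval, I ≤ K ∧ J ≤ K := by
  obtain ⟨a, ha⟩ := (I.1 ∪ J.1).bddBelow
  obtain ⟨b, hb⟩ := (I.1 ∪ J.1).bddAbove
  refine ⟨⟨Finset.Icc a b, by rw [Finset.coe_Icc]; exact Set.ordConnected_Icc⟩, ?_, ?_⟩
  · intro i hi
    have hi' : i ∈ ((I.1 ∪ J.1 : Finset ℤ) : Set ℤ) := by simp [show i ∈ I.1 from hi]
    exact Finset.mem_Icc.2 ⟨ha hi', hb hi'⟩
  · intro i hi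
    have hi' : i ∈ ((I.1 ∪ J.1 : Finset ℤ) : Set ℤ) := by simp [show i ∈ J.1 from hi]
    exact Finset.mem_Icc.2 ⟨ha hi', hb hi'⟩

end FinInterval

/-! ### Quasi-local algebras, shifts and multiplicative states -/

/-- A quasi-local algebra over the finite intervals of `ℤ`: a unital C*-algebra `𝔐` with a family
`M_I` of W*-subalgebras, all containing the unit of `𝔐`, which is increasing in `I`, has a dense
union, and is such that `M_I` and `M_J` commute when `I` and `J` are disjoint; by convention
`M_∅ = ℂ1`. -/
structure QuasiLocalAlgebra (𝔐 : Type*) [CStarAlgebra 𝔐] where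
  /-- The algebra of the interval `I`. -/
  alg : FinInterval → StarSubalgebra ℂ 𝔐
  isClosed : ∀ I, IsClosed (alg I : Set 𝔐)
  isWStar : ∀ I, haveI := isClosed I; WStarAlgebra (alg I)
  alg_empty : alg FinInterval.empty = ⊥
  mono : ∀ I J : FinInterval, I ≤ J → alg I ≤ alg J
  dense : Dense (⋃ I, (alg I : Set 𝔐))
  commute : ∀ I J : FinInterval, Disjoint I.1 J.1 → ∀ x ∈ alg I, ∀ y ∈ alg J, Commute x y

/-- A shift action on a quasi-local algebra: an action of `ℤ` on `𝔐` by `*`-automorphisms `γ_j`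
with `γ_j(M_I) = M_{I+j}`. -/
structure ShiftAction {𝔐 : Type*} [CStarAlgebra 𝔐] (Q : QuasiLocalAlgebra 𝔐) where
  /-- The action, as a group homomorphism. -/
  toHom : Multiplicative ℤ →* (𝔐 ≃⋆ₐ[ℂ] 𝔐)
  map_alg : ∀ (I : FinInterval) (j : ℤ),
    (fun x => toHom (Multiplicative.ofAdd j) x) '' (Q.alg I : Set 𝔐) = Q.alg (I.shift j)

/-- The automorphism `γ_j`. -/
def ShiftAction.aut {𝔐 : Type*} [CStarAlgebra 𝔐] {Q : QuasiLocalAlgebra 𝔐} (γ : ShiftAction Q)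
    (j : ℤ) : 𝔐 ≃⋆ₐ[ℂ] 𝔐 := γ.toHom (Multiplicative.ofAdd j)

/-- A state on `𝔐` that is invariant under the shifts `γ_j` and multiplicative:
`χ(xy) = χ(x)χ(y)` for `x ∈ M_I`, `y ∈ M_J` with `I`, `J` disjoint. -/
structure InvMultState {𝔐 : Type*} [CStarAlgebra 𝔐] {Q : QuasiLocalAlgebra 𝔐}
    (γ : ShiftAction Q) where
  /-- The underlying linear functional. -/
  toFun : 𝔐 →ₗ[ℂ] ℂ
  isState : IsState toFun
  invariant : ∀ (j : ℤ) (x : 𝔐), toFun (γ.aut j x) = toFun x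
  multiplicative : ∀ I J : FinInterval, Disjoint I.1 J.1 → ∀ x ∈ Q.alg I, ∀ y ∈ Q.alg J,
    toFun (x * y) = toFun x * toFun y

/-- The real vector space `𝔐_{0,sa}` of self-adjoint local observables. -/
def QuasiLocalAlgebra.localSA {𝔐 : Type*} [CStarAlgebra 𝔐] (Q : QuasiLocalAlgebra 𝔐) :
    Submodule ℝ 𝔐 where
  carrier := {x | IsSelfAdjoint x ∧ ∃ I, x ∈ Q.alg I}
  add_mem' := by
    rintro x y ⟨hx, I, hI⟩ ⟨hy, J, hJ⟩
    obtain ⟨K, hIK, hJK⟩ := FinInterval.directed I J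
    exact ⟨hx.add hy, K, add_mem (Q.mono _ _ hIK hI) (Q.mono _ _ hJK hJ)⟩
  zero_mem' := ⟨.zero _, FinInterval.empty, zero_mem _⟩
  smul_mem' := by
    rintro c x ⟨hx, I, hI⟩
    refine ⟨?_, I, ?_⟩
    · rw [IsSelfAdjoint, star_smul, hx.star_eq, star_trivial]
    · have h : (c : ℂ) • x ∈ Q.alg I := (Q.alg I).smul_mem hI (c : ℂ)
      rwa [Complex.coe_smul] at h

/-- The local fluctuation `F_I(x) = |I|^{-1/2} ∑_{j ∈ I} (γ_j(x) - χ(x)1)`. -/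
def fluctuation {𝔐 : Type*} [CStarAlgebra 𝔐] {Q : QuasiLocalAlgebra 𝔐} {γ : ShiftAction Q}
    (χ : InvMultState γ) (I : FinInterval) (x : 𝔐) : 𝔐 :=
  (((Real.sqrt (I.1.card : ℝ))⁻¹ : ℝ) : ℂ) • ∑ j ∈ I.1, (γ.aut j x - χ.toFun x • (1 : 𝔐))

/-! ### The forms `s_χ` and `σ_χ` -/

/-- The correlation `χ(x γ_k(y)) - χ(x) χ(y)`. -/
def corr {𝔐 : Type*} [CStarAlgebra 𝔐] {Q : QuasiLocalAlgebra 𝔐} {γ : ShiftAction Q}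
    (χ : InvMultState γ) (x y : 𝔐) (k : ℤ) : ℂ :=
  χ.toFun (x * γ.aut k y) - χ.toFun x * χ.toFun y

/-- `s_χ(x, y) = Re ∑_{k ∈ ℤ} (χ(x γ_k(y)) - χ(x) χ(y))`. -/
def sForm {𝔐 : Type*} [CStarAlgebra 𝔐] {Q : QuasiLocalAlgebra 𝔐} {γ : ShiftAction Q}
    (χ : InvMultState γ) (x y : Q.localSA) : ℝ :=
  (∑' k : ℤ, corr χ (x : 𝔐) (y : 𝔐) k).re

theorem corr_summable {𝔐 : Type*} [CStarAlgebra 𝔐] {Q : QuasiLocalAlgebra 𝔐} {γ : ShiftAction Q}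
    (χ : InvMultState γ) (x y : Q.localSA) : Summable (corr χ (x : 𝔐) (y : 𝔐)) := by
  obtain ⟨x, -, I, hI⟩ := x
  obtain ⟨y, -, J, hJ⟩ := y
  refine summable_of_ne_finset_zero (s := Finset.image₂ (fun i j => i - j) I.1 J.1) ?_
  intro k hk
  have hy : γ.aut k y ∈ Q.alg (J.shift k) := by
    have : γ.aut k y ∈ (Q.alg (J.shift k) : Set 𝔐) := by
      rw [← γ.map_alg J k]; exact ⟨y, hJ, rfl⟩
    exact this
  have hd : Disjoint I.1 (J.shift k).1 := by
    rw [Finset.disjoint_left]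
    intro i hi hi'
    obtain ⟨j, hj, rfl⟩ := Finset.mem_image.1 hi'
    exact hk (Finset.mem_image₂.2 ⟨j + k, hi, j, hj, by ring⟩)
  simp only [corr]
  rw [χ.multiplicative I _ hd x hI _ hy, χ.invariant, sub_self]

/-- A symplectic form on a real vector space: a real bilinear form with `σ(x, x) = 0`.
It is allowed to be degenerate. -/
structure SymplecticForm (V : Type*) [AddCommGroup V] [Module ℝ V] where
  /-- The bilinear form. -/
  toBilin : V →ₗ[ℝ] V →ₗ[ℝ] ℝ
  self_eq_zero : ∀ x, toBilin x x = 0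

theorem SymplecticForm.neg_swap {V : Type*} [AddCommGroup V] [Module ℝ V] (σ : SymplecticForm V)
    (x y : V) : σ.toBilin y x = -σ.toBilin x y := by
  have h := σ.self_eq_zero (x + y)
  simp only [map_add, LinearMap.add_apply, σ.self_eq_zero] at h
  linarith

/-- `σ_χ(x, y) = -Im ∑_{k ∈ ℤ} (χ(x γ_k(y)) - χ(x) χ(y))`. -/
def sigmaForm {𝔐 : Type*} [CStarAlgebra 𝔐] {Q : QuasiLocalAlgebra 𝔐} {γ : ShiftAction Q}
    (χ : InvMultState γ) : SymplecticForm Q.localSA where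
  toBilin := LinearMap.mk₂ ℝ
    (fun x y => -(∑' k : ℤ, corr χ (x : 𝔐) (y : 𝔐) k).im)
    (by
      intro x x' y
      have h : corr χ ((x + x' : Q.localSA) : 𝔐) (y : 𝔐)
          = fun k => corr χ (x : 𝔐) (y : 𝔐) k + corr χ (x' : 𝔐) (y : 𝔐) k := by
        funext k
        simp only [corr, Submodule.coe_add, add_mul, map_add]; ring
      rw [h, (corr_summable χ x y).tsum_add (corr_summable χ x' y), Complex.add_im]; ring)
    (by
      intro c x y
      have h : corr χ ((c • x : Q.localSA) : 𝔐) (y : 𝔐)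
          = fun k => (c : ℂ) * corr χ (x : 𝔐) (y : 𝔐) k := by
        funext k
        simp only [corr, Submodule.coe_smul]
        rw [← Complex.coe_smul, smul_mul_assoc, map_smul, map_smul, smul_eq_mul, smul_eq_mul]
        ring
      rw [h, tsum_mul_left, Complex.im_ofReal_mul, smul_eq_mul]; ring)
    (by
      intro x y y'
      have h : corr χ (x : 𝔐) ((y + y' : Q.localSA) : 𝔐)
          = fun k => corr χ (x : 𝔐) (y : 𝔐) k + corr χ (x : 𝔐) (y' : 𝔐) k := by
        funext k
        simp only [corr, Submodule.coe_add, map_add, mul_add]; ring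
      rw [h, (corr_summable χ x y).tsum_add (corr_summable χ x y'), Complex.add_im]; ring)
    (by
      intro c x y
      have h : corr χ (x : 𝔐) ((c • y : Q.localSA) : 𝔐)
          = fun k => (c : ℂ) * corr χ (x : 𝔐) (y : 𝔐) k := by
        funext k
        simp only [corr, Submodule.coe_smul]
        rw [← Complex.coe_smul, map_smul, mul_smul_comm, map_smul, map_smul, smul_eq_mul,
          smul_eq_mul]
        ring
      rw [h, tsum_mul_left, Complex.im_ofReal_mul, smul_eq_mul]; ring)
  self_eq_zero := by
    intro x
    have hx : star (x : 𝔐) = x := x.2.1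
    have h : ∀ k, star (corr χ (x : 𝔐) (x : 𝔐) k) = corr χ (x : 𝔐) (x : 𝔐) (-k) := by
      intro k
      have hγ : γ.aut (-k) (γ.aut k (x : 𝔐)) = x := by
        have : γ.aut (-k) * γ.aut k = 1 := by
          simp only [ShiftAction.aut, ofAdd_neg, map_inv, inv_mul_cancel]
        exact congrArg (fun e : 𝔐 ≃⋆ₐ[ℂ] 𝔐 => e (x : 𝔐)) this
      simp only [corr]
      rw [star_sub, star_mul', ← χ.isState.map_star, ← χ.isState.map_star, star_mul, hx,
        ← map_star (γ.aut k), hx, ← χ.invariant (-k), map_mul, hγ]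
    have hs : star (∑' k : ℤ, corr χ (x : 𝔐) (x : 𝔐) k) = ∑' k : ℤ, corr χ (x : 𝔐) (x : 𝔐) k := by
      rw [tsum_star, tsum_congr h]
      exact (Equiv.neg ℤ).tsum_eq (corr χ (x : 𝔐) (x : 𝔐))
    have := congrArg Complex.im hs
    simp only [Complex.star_def, Complex.conj_im] at this
    simp only [LinearMap.mk₂_apply]
    linarith

/-! ### The Weyl CCR algebra -/

/-- The unital `*`-algebra generated by elements `w(x)`, `x ∈ V`, subject to
`w(x)* = w(-x)` and `w(x) w(y) = e^{iσ(x,y)} w(x+y)`. The elements `w(x)` form a linear basis,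
so it is realised on the space of finitely supported functions on `V`. -/
def WeylPoly {V : Type*} [AddCommGroup V] [Module ℝ V] (_σ : SymplecticForm V) : Type _ := V →₀ ℂ

namespace WeylPoly

variable {V : Type*} [AddCommGroup V] [Module ℝ V] {σ : SymplecticForm V}

instance : AddCommGroup (WeylPoly σ) := inferInstanceAs (AddCommGroup (V →₀ ℂ))
instance : Module ℂ (WeylPoly σ) := inferInstanceAs (Module ℂ (V →₀ ℂ))

variable (σ) in
/-- The linear basis formed by the generators. -/
def basis : Module.Basis V ℂ (WeylPoly σ) := ⟨LinearEquiv.refl ℂ (V →₀ ℂ)⟩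

variable (σ) in
/-- The generator `w(x)`. -/
def gen (x : V) : WeylPoly σ := basis σ x

variable (σ) in
/-- The phase `e^{iσ(x,y)}`. -/
def phase (x y : V) : ℂ := Complex.exp (Complex.I * (σ.toBilin x y : ℂ))

theorem smul_gen (a : ℂ) (x : V) : (basis σ).repr.symm (Finsupp.single x a) = a • gen σ x := by
  rw [gen, Module.Basis.repr_symm_single]

@[elab_as_elim]
theorem induction {p : WeylPoly σ → Prop} (f : WeylPoly σ) (zero : p 0)
    (add : ∀ f g, p f → p g → p (f + g)) (smul_gen : ∀ (a : ℂ) (x : V), p (a • gen σ x)) :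
    p f := by
  have h : ∀ l : V →₀ ℂ, p ((basis σ).repr.symm l) := by
    intro l
    induction l using Finsupp.induction_linear with
    | zero => rwa [map_zero]
    | add f g hf hg => rw [map_add]; exact add _ _ hf hg
    | single x a => rw [WeylPoly.smul_gen]; exact smul_gen a x
  have := h ((basis σ).repr f)
  rwa [LinearEquiv.symm_apply_apply] at this

variable (σ) in
/-- The multiplication, as a bilinear map: `w(x) w(y) = e^{iσ(x,y)} w(x+y)`. -/
def mulLin : WeylPoly σ →ₗ[ℂ] WeylPoly σ →ₗ[ℂ] WeylPoly σ :=
  (basis σ).constr ℂ fun x => (basis σ).constr ℂ fun y => phase σ x y • gen σ (x + y)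

instance : Mul (WeylPoly σ) := ⟨fun f g => mulLin σ f g⟩
instance : One (WeylPoly σ) := ⟨gen σ 0⟩

theorem mul_def (f g : WeylPoly σ) : f * g = mulLin σ f g := rfl
theorem one_def : (1 : WeylPoly σ) = gen σ 0 := rfl

theorem gen_mul_gen (x y : V) : gen σ x * gen σ y = phase σ x y • gen σ (x + y) := by
  rw [mul_def, mulLin, gen, gen, Module.Basis.constr_basis, Module.Basis.constr_basis]

theorem phase_cocycle (x y z : V) :
    phase σ x y * phase σ (x + y) z = phase σ y z * phase σ x (y + z) := by
  simp only [phase, ← Complex.exp_add, map_add, LinearMap.add_apply]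
  push_cast
  congr 1; ring

instance : Ring (WeylPoly σ) where
  left_distrib f g h := by simp only [mul_def, map_add]
  right_distrib f g h := by simp only [mul_def, map_add, LinearMap.add_apply]
  zero_mul f := by simp only [mul_def, map_zero, LinearMap.zero_apply]
  mul_zero f := by simp only [mul_def, map_zero]
  one_mul f := by
    induction f using induction with
    | zero => simp only [mul_def, map_zero]
    | add f g hf hg => simp only [mul_def, map_add] at *; rw [hf, hg]
    | smul_gen a x =>
      rw [mul_def, map_smul, one_def, ← mul_def, gen_mul_gen, zero_add]
      simp [phase]
  mul_one f := by
    induction f using induction with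
    | zero => simp only [mul_def, map_zero, LinearMap.zero_apply]
    | add f g hf hg =>
      simp only [mul_def, map_add, LinearMap.add_apply] at *; rw [hf, hg]
    | smul_gen a x =>
      rw [mul_def, map_smul, LinearMap.smul_apply, one_def, ← mul_def, gen_mul_gen, add_zero]
      simp [phase]
  mul_assoc f g h := by
    induction f using induction with
    | zero => simp only [mul_def, map_zero, LinearMap.zero_apply]
    | add f f' hf hf' => simp only [mul_def, map_add, LinearMap.add_apply] at *; rw [hf, hf']
    | smul_gen a x =>
    induction g using induction with
    | zero => simp only [mul_def, map_zero, LinearMap.zero_apply]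
    | add f f' hf hf' => simp only [mul_def, map_add, LinearMap.add_apply] at *; rw [hf, hf']
    | smul_gen b y =>
    induction h using induction with
    | zero => simp only [mul_def, map_zero]
    | add f f' hf hf' => simp only [mul_def, map_add] at *; rw [hf, hf']
    | smul_gen c z =>
    have e : gen σ x * gen σ y * gen σ z = gen σ x * (gen σ y * gen σ z) := by
      rw [gen_mul_gen, gen_mul_gen, mul_def, map_smul, LinearMap.smul_apply, ← mul_def,
        mul_def (gen σ x), map_smul, ← mul_def, gen_mul_gen, gen_mul_gen, smul_smul, smul_smul,
        phase_cocycle, add_assoc]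
    simp only [mul_def, map_smul, LinearMap.smul_apply] at *
    rw [e]
  zsmul := (inferInstance : AddCommGroup (WeylPoly σ)).zsmul
  zsmul_zero' := (inferInstance : AddCommGroup (WeylPoly σ)).zsmul_zero'
  zsmul_succ' := (inferInstance : AddCommGroup (WeylPoly σ)).zsmul_succ'
  zsmul_neg' := (inferInstance : AddCommGroup (WeylPoly σ)).zsmul_neg'
  sub_eq_add_neg := (inferInstance : AddCommGroup (WeylPoly σ)).sub_eq_add_neg
  neg_add_cancel := neg_add_cancel

instance : Algebra ℂ (WeylPoly σ) :=
  Algebra.ofModule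
    (fun a f g => by simp only [mul_def, map_smul, LinearMap.smul_apply])
    (fun a f g => by simp only [mul_def, map_smul])

/-- The involution, determined by conjugate linearity and `w(x)* = w(-x)`. -/
instance : Star (WeylPoly σ) :=
  ⟨fun f => ((basis σ).repr f).sum fun x a => star a • gen σ (-x)⟩

theorem star_def (f : WeylPoly σ) :
    star f = ((basis σ).repr f).sum fun x a => star a • gen σ (-x) := rfl

theorem star_add' (f g : WeylPoly σ) : star (f + g) = star f + star g := by
  rw [star_def, star_def, star_def, map_add]
  exact Finsupp.sum_add_index' (fun x => by rw [star_zero, zero_smul])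
    (fun x a b => by rw [star_add, add_smul])

theorem star_zero' : star (0 : WeylPoly σ) = 0 := by
  rw [star_def, map_zero, Finsupp.sum_zero_index]

theorem star_smul_gen (a : ℂ) (x : V) : star (a • gen σ x) = star a • gen σ (-x) := by
  rw [star_def, ← smul_gen, LinearEquiv.apply_symm_apply,
    Finsupp.sum_single_index (by rw [star_zero, zero_smul])]

theorem star_gen (x : V) : star (gen σ x) = gen σ (-x) := by
  have := star_smul_gen (σ := σ) 1 x
  rwa [star_one, one_smul, one_smul] at this

theorem star_phase (x y : V) : star (phase σ x y) = phase σ (-y) (-x) := by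
  simp only [phase, Complex.star_def, ← Complex.exp_conj, map_mul, Complex.conj_I,
    Complex.conj_ofReal, map_neg, LinearMap.neg_apply, neg_neg]
  rw [σ.neg_swap x y]
  push_cast
  congr 1; ring

instance : StarRing (WeylPoly σ) where
  star_involutive f := by
    induction f using induction with
    | zero => rw [star_zero', star_zero']
    | add f g hf hg => rw [star_add', star_add', hf, hg]
    | smul_gen a x => rw [star_smul_gen, star_smul_gen, star_star, neg_neg]
  star_mul f g := by
    induction f using induction with
    | zero => rw [zero_mul, star_zero', mul_zero]
    | add f f' hf hf' => rw [add_mul, star_add', star_add', hf, hf', mul_add]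
    | smul_gen a x =>
    induction g using induction with
    | zero => rw [mul_zero, star_zero', zero_mul]
    | add f f' hf hf' => rw [mul_add, star_add', star_add', hf, hf', add_mul]
    | smul_gen b y =>
    rw [star_smul_gen, star_smul_gen, smul_mul_smul_comm, smul_mul_smul_comm, gen_mul_gen,
      gen_mul_gen, smul_smul, smul_smul, star_smul_gen, star_mul', star_mul', star_phase,
      neg_add_rev, mul_comm (star a)]
  star_add := star_add'

instance : StarModule ℂ (WeylPoly σ) where
  star_smul c f := by
    induction f using induction with
    | zero => rw [smul_zero, star_zero', smul_zero]
    | add f g hf hg => rw [smul_add, star_add', star_add', hf, hg, smul_add]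
    | smul_gen a x => rw [smul_smul, star_smul_gen, star_smul_gen, star_mul', smul_smul]

/-- A C*-seminorm: a submultiplicative seminorm with `p(a* a) = p(a)²`. -/
structure IsCStarSeminorm (p : Seminorm ℂ (WeylPoly σ)) : Prop where
  mul_le : ∀ a b, p (a * b) ≤ p a * p b
  star_mul_self : ∀ a, p (star a * a) = p a * p a

theorem IsCStarSeminorm.gen_le {p : Seminorm ℂ (WeylPoly σ)} (hp : IsCStarSeminorm p) (x : V) :
    p (gen σ x) ≤ 1 := by
  have one : p 1 ≤ 1 := by
    have h := hp.star_mul_self 1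
    rw [star_one, one_mul] at h
    nlinarith [apply_nonneg p (1 : WeylPoly σ)]
  have h := hp.star_mul_self (gen σ x)
  have e : star (gen σ x) * gen σ x = 1 := by
    rw [star_gen, gen_mul_gen, neg_add_cancel, one_def, phase, map_neg, LinearMap.neg_apply,
      σ.self_eq_zero]
    simp
  rw [e] at h
  nlinarith [apply_nonneg p (gen σ x)]

theorem bounded (f : WeylPoly σ) :
    ∃ C : ℝ, ∀ p : {p : Seminorm ℂ (WeylPoly σ) // IsCStarSeminorm p}, p.1 f ≤ C := by
  induction f using induction with
  | zero => exact ⟨0, fun p => (map_zero p.1).le⟩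
  | add f g hf hg =>
    obtain ⟨C, hC⟩ := hf
    obtain ⟨D, hD⟩ := hg
    exact ⟨C + D, fun p => (map_add_le_add p.1 f g).trans (add_le_add (hC p) (hD p))⟩
  | smul_gen a x =>
    refine ⟨‖a‖, fun p => ?_⟩
    rw [map_smul_eq_mul]
    exact mul_le_of_le_one_right (norm_nonneg a) (p.2.gen_le x)

theorem bddAbove (f : WeylPoly σ) : BddAbove (Set.range
    fun p : {p : Seminorm ℂ (WeylPoly σ) // IsCStarSeminorm p} => p.1 f) := by
  obtain ⟨C, hC⟩ := bounded f
  exact ⟨C, by rintro _ ⟨p, rfl⟩; exact hC p⟩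

instance : Nonempty {p : Seminorm ℂ (WeylPoly σ) // IsCStarSeminorm p} :=
  ⟨⟨0, ⟨fun _ _ => by simp, fun _ => by simp⟩⟩⟩

/-- The universal C*-seminorm: the supremum of all C*-seminorms. -/
instance : Norm (WeylPoly σ) :=
  ⟨fun f => ⨆ p : {p : Seminorm ℂ (WeylPoly σ) // IsCStarSeminorm p}, p.1 f⟩

theorem norm_def (f : WeylPoly σ) :
    ‖f‖ = ⨆ p : {p : Seminorm ℂ (WeylPoly σ) // IsCStarSeminorm p}, p.1 f := rfl

theorem le_norm (p : {p : Seminorm ℂ (WeylPoly σ) // IsCStarSeminorm p}) (f : WeylPoly σ) :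
    p.1 f ≤ ‖f‖ := le_ciSup (bddAbove f) p

theorem norm_nonneg' (f : WeylPoly σ) : 0 ≤ ‖f‖ :=
  Real.iSup_nonneg fun p => apply_nonneg p.1 f

theorem norm_mul_le' (f g : WeylPoly σ) : ‖f * g‖ ≤ ‖f‖ * ‖g‖ :=
  ciSup_le fun p => (p.2.mul_le f g).trans
    (mul_le_mul (le_norm p f) (le_norm p g) (apply_nonneg _ _) (norm_nonneg' f))

theorem norm_smul_le' (a : ℂ) (f : WeylPoly σ) : ‖a • f‖ ≤ ‖a‖ * ‖f‖ := by
  refine ciSup_le fun p => ?_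
  rw [map_smul_eq_mul]
  exact mul_le_mul_of_nonneg_left (le_norm p f) (norm_nonneg a)

theorem norm_star_mul_self' (f : WeylPoly σ) : ‖f‖ * ‖f‖ ≤ ‖star f * f‖ := by
  have h : ‖f‖ ≤ Real.sqrt ‖star f * f‖ := by
    refine ciSup_le fun p => Real.le_sqrt_of_sq_le ?_
    rw [sq, ← p.2.star_mul_self]
    exact le_norm p _
  have h' := mul_self_le_mul_self (norm_nonneg' f) h
  rwa [Real.mul_self_sqrt (norm_nonneg' _)] at h'

instance : SeminormedRing (WeylPoly σ) where
  __ := (inferInstance : Ring (WeylPoly σ))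
  __ := AddGroupSeminorm.toSeminormedAddCommGroup
    { toFun := fun f : WeylPoly σ => ‖f‖
      map_zero' := by simp [norm_def]
      add_le' := fun f g => ciSup_le fun p =>
        (map_add_le_add p.1 f g).trans (add_le_add (le_norm p f) (le_norm p g))
      neg' := fun f => by simp [norm_def] }
  norm_mul_le := norm_mul_le'

instance : NormedAlgebra ℂ (WeylPoly σ) where
  norm_smul_le := norm_smul_le'

theorem norm_star_mul_self_eq (f : WeylPoly σ) : ‖star f * f‖ = ‖f‖ * ‖f‖ := by
  refine le_antisymm (ciSup_le fun p => ?_) (norm_star_mul_self' f)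
  rw [p.2.star_mul_self]
  exact mul_self_le_mul_self (apply_nonneg _ _) (le_norm p f)

theorem norm_star' (f : WeylPoly σ) : ‖star f‖ = ‖f‖ := by
  have key : ∀ g : WeylPoly σ, ‖g‖ ≤ ‖star g‖ := by
    intro g
    rcases (norm_nonneg' g).eq_or_lt with h | h
    · rw [← h]; exact norm_nonneg' _
    · have h1 := (norm_star_mul_self' g).trans (norm_mul_le' (star g) g)
      exact le_of_mul_le_mul_right h1 h
  refine le_antisymm ?_ (key f)
  have := key (star f)
  rwa [star_star] at this

theorem isometry_star : Isometry (star : WeylPoly σ → WeylPoly σ) := by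
  refine Isometry.of_dist_eq fun f g => ?_
  rw [dist_eq_norm, dist_eq_norm, ← star_sub, norm_star']

end WeylPoly

open UniformSpace in
/-- The Weyl CCR algebra of `(V, σ)`: the universal C*-algebra generated by elements `w(x)`,
`x ∈ V`, subject to `w(x)* = w(-x)` and `w(x) w(y) = e^{iσ(x,y)} w(x+y)`, that is, the Hausdorff
completion of the `*`-algebra with these generators and relations in its largest C*-seminorm. -/
def WeylAlgebra {V : Type*} [AddCommGroup V] [Module ℝ V] (σ : SymplecticForm V) : Type _ :=
  Completion (WeylPoly σ)

namespace WeylAlgebra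

open UniformSpace

variable {V : Type*} [AddCommGroup V] [Module ℝ V] {σ : SymplecticForm V}

instance : NormedRing (WeylAlgebra σ) := inferInstanceAs (NormedRing (Completion (WeylPoly σ)))
instance : CompleteSpace (WeylAlgebra σ) :=
  inferInstanceAs (CompleteSpace (Completion (WeylPoly σ)))
instance : Algebra ℂ (WeylAlgebra σ) := inferInstanceAs (Algebra ℂ (Completion (WeylPoly σ)))

/-- The canonical map from the `*`-algebra of generators and relations. -/
def of (f : WeylPoly σ) : WeylAlgebra σ := (f : Completion (WeylPoly σ))

theorem of_add (f g : WeylPoly σ) : of (f + g) = of f + of g := Completion.coe_add f g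
theorem of_mul (f g : WeylPoly σ) : of (f * g) = of f * of g := Completion.coe_mul f g
theorem of_one : of (1 : WeylPoly σ) = 1 := Completion.coe_one (WeylPoly σ)
theorem of_smul (c : ℂ) (f : WeylPoly σ) : of (c • f) = c • of f := Completion.coe_smul c f
theorem norm_of (f : WeylPoly σ) : ‖of f‖ = ‖f‖ := Completion.norm_coe f
theorem continuous_of : Continuous (of : WeylPoly σ → WeylAlgebra σ) :=
  Completion.continuous_coe (WeylPoly σ)
theorem denseRange_of : DenseRange (of : WeylPoly σ → WeylAlgebra σ) :=
  Completion.denseRange_coe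

instance : NormedAlgebra ℂ (WeylAlgebra σ) where
  norm_smul_le c a :=
    norm_smul_le (α := ℂ) (β := Completion (WeylPoly σ)) c a

/-- The involution, extended by continuity. -/
instance : Star (WeylAlgebra σ) :=
  ⟨Completion.map (star : WeylPoly σ → WeylPoly σ)⟩

theorem star_of (f : WeylPoly σ) : star (of f) = of (star f) :=
  Completion.map_coe WeylPoly.isometry_star.uniformContinuous f

theorem continuous_star' : Continuous (star : WeylAlgebra σ → WeylAlgebra σ) :=
  Completion.continuous_map

instance : StarRing (WeylAlgebra σ) where
  star_involutive a := denseRange_of.induction_on a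
    (isClosed_eq (continuous_star'.comp continuous_star') continuous_id)
    fun f => by rw [star_of, star_of, star_star]
  star_mul a b := denseRange_of.induction_on₂
    (isClosed_eq (continuous_star'.comp (continuous_fst.mul continuous_snd))
      ((continuous_star'.comp continuous_snd).mul (continuous_star'.comp continuous_fst)))
    (fun f g => by rw [← of_mul, star_of, star_of, star_of, star_mul, of_mul]) a b
  star_add a b := denseRange_of.induction_on₂
    (isClosed_eq (continuous_star'.comp (continuous_fst.add continuous_snd))
      ((continuous_star'.comp continuous_fst).add (continuous_star'.comp continuous_snd)))
    (fun f g => by rw [← of_add, star_of, star_of, star_of, star_add, of_add]) a b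

instance : StarModule ℂ (WeylAlgebra σ) where
  star_smul c a := denseRange_of.induction_on a
    (isClosed_eq (continuous_star'.comp (continuous_const_smul c))
      (continuous_star'.const_smul (star c)))
    fun f => by rw [← of_smul, star_of, star_of, star_smul, of_smul]

instance : CStarRing (WeylAlgebra σ) where
  norm_mul_self_le a := by
    refine denseRange_of.induction_on (p := fun a : WeylAlgebra σ => ‖a‖ * ‖a‖ ≤ ‖star a * a‖) a
      (isClosed_le (continuous_norm.mul continuous_norm)
        (continuous_norm.comp (continuous_star'.mul continuous_id))) fun f => ?_
    rw [star_of, ← of_mul, norm_of, norm_of, WeylPoly.norm_star_mul_self_eq]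

instance : CStarAlgebra (WeylAlgebra σ) where

variable (σ) in
/-- The Weyl element `w(x)`. -/
def w (x : V) : WeylAlgebra σ := of (WeylPoly.gen σ x)

theorem star_w (x : V) : star (w σ x) = w σ (-x) := by
  rw [w, star_of, WeylPoly.star_gen, w]

theorem w_mul_w (x y : V) :
    w σ x * w σ y = Complex.exp (Complex.I * (σ.toBilin x y : ℂ)) • w σ (x + y) := by
  rw [w, w, ← of_mul, WeylPoly.gen_mul_gen, of_smul]; rfl

end WeylAlgebra

/-- `φ` is the quasi-free state on the Weyl CCR algebra with covariance `s`: it is a state with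
`φ(w(x)) = e^{-s(x,x)/2}` for all `x`. -/
structure IsQuasiFreeState {V : Type*} [AddCommGroup V] [Module ℝ V] {σ : SymplecticForm V}
    (s : V → V → ℝ) (φ : WeylAlgebra σ →ₗ[ℂ] ℂ) : Prop where
  isState : IsState φ
  map_w : ∀ x, φ (WeylAlgebra.w σ x) = (Real.exp (-(s x x) / 2) : ℂ)

end

/-! This is a central limit theorem by Bernstein's block method. Finitely many local observables lie
in a common cell of length `r`. Translates of them by amounts differing by at least `r` commute and
are independent under `χ`. By invariance `I_n` may be replaced by `[0, N)` with `N = |I_n|`, and the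
observables may be centred. Cut `[0, N)` into blocks of length `L` separated by gaps of length `r`.
On the blocks, the expectation of the product of exponentials is exactly a power `z(t) ^ (N / (L +
r))` with `t = N^{-1/2}` (`InvMultState.apply_weylProd_localSum_blocks`). The expansion `z(t) = 1 -
t² κ_L + o(t²)` makes this power tend to `exp (-κ_L / (L + r))` (`tendsto_pow_nat_div_exp`). Cesàro
averaging identifies the limit of `κ_L / (L + r)` as `L → ∞` with `covQuad`
(`tendsto_apply_weylQuad_div`).

Discarding the gaps is the analytic point, since the discarded part is not shown to be small in
norm. Its seminorm `χ(a* a)^{1/2}` and its commutators with the remaining sums are nevertheless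
controlled by the density of discarded points. A Duhamel estimate shows that this suffices
(`IsState.norm_weylProd_sub_le`). Letting `N → ∞` and then `L → ∞` gives the limit `exp (-covQuad)`,
which is also the value of the Gaussian functional on a product of Weyl generators
(`apply_prod_gen`).

Existence of the quasi-free state is a corollary of the limit theorem. The two-factor case exhibits
the Gaussian functional on the Weyl `*`-algebra as a limit of positive functionals of the form `f ↦
χ(A* A)`, with `A` linear in `f` (`isState_quasiFree`). A state on the `*`-algebra is bounded by the
universal norm because its GNS operator seminorm is a C*-seminorm, so it extends to the completion
(`WeylAlgebra.exists_state_extension`). Uniqueness holds because the Weyl elements span a dense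
subspace. -/

noncomputable section
open scoped ComplexOrder

/-! ### The GNS seminorm of a state. -/

namespace IsState

section GNS

variable {A : Type*} [Ring A] [StarRing A] [Algebra ℂ A] [StarModule ℂ A] {φ : A →ₗ[ℂ] ℂ}

/-- The sesquilinear form `(a, b) ↦ φ(a* b)` of a state. -/
@[reducible]
def preCore (h : IsState φ) : PreInnerProductSpace.Core ℂ A where
  inner a b := φ (star a * b)
  conj_inner_symm a b := by
    rw [starRingEnd_apply, ← h.map_star, star_mul, star_star]
  re_inner_nonneg a := (Complex.nonneg_iff.1 (h.nonneg a)).1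
  add_left a b c := by rw [star_add, add_mul, map_add]
  smul_left a b c := by
    rw [star_smul, smul_mul_assoc, map_smul, smul_eq_mul]; rfl

/-- The algebra with the GNS seminorm of a state. -/
def PreGNS (_h : IsState φ) : Type _ := A

variable (h : IsState φ)

instance : SeminormedAddCommGroup h.PreGNS :=
  @InnerProductSpace.Core.toSeminormedAddCommGroup ℂ A _ _ _ h.preCore
instance : InnerProductSpace ℂ h.PreGNS := InnerProductSpace.ofCore h.preCore

/-- The GNS vector of an element. -/
def vec : A →ₗ[ℂ] h.PreGNS where
  toFun a := a
  map_add' _ _ := rfl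
  map_smul' _ _ := rfl

theorem inner_vec (a b : A) : inner ℂ (h.vec a) (h.vec b) = φ (star a * b) := rfl

theorem norm_vec_sq (a : A) : ‖h.vec a‖ ^ 2 = (φ (star a * a)).re := by
  rw [← inner_vec, ← inner_self_eq_norm_sq (𝕜 := ℂ)]; rfl

theorem norm_apply_star_mul_le (a b : A) : ‖φ (star a * b)‖ ≤ ‖h.vec a‖ * ‖h.vec b‖ :=
  norm_inner_le_norm (𝕜 := ℂ) (h.vec a) (h.vec b)

theorem norm_vec_one : ‖h.vec 1‖ = 1 := by
  have e := h.norm_vec_sq 1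
  rw [star_one, one_mul, h.map_one, Complex.one_re] at e
  exact (pow_eq_one_iff_of_nonneg (norm_nonneg _) two_ne_zero).1 e

/-- Only left factors drop out of the GNS seminorm. Unitaries on the right must first be moved to
the left, which costs commutators. -/
theorem norm_vec_mul_of_unitary {u : A} (hu : star u * u = 1) (a : A) :
    ‖h.vec (u * a)‖ = ‖h.vec a‖ := by
  have e : ‖h.vec (u * a)‖ ^ 2 = ‖h.vec a‖ ^ 2 := by
    rw [norm_vec_sq, norm_vec_sq, star_mul, mul_assoc, ← mul_assoc (star u), hu, one_mul]
  exact (pow_left_inj₀ (norm_nonneg _) (norm_nonneg _) two_ne_zero).1 e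

theorem norm_apply_le (a : A) : ‖φ a‖ ≤ ‖h.vec a‖ := by
  simpa [norm_vec_one] using h.norm_apply_star_mul_le 1 a

end GNS

section CStar

variable {A : Type*} [CStarAlgebra A] {φ : A →ₗ[ℂ] ℂ}

/-- The element `‖a‖² - a* a` is positive, hence of the form `c* c`, and the state is nonnegative on
it. -/
theorem norm_vec_le (h : IsState φ) (a : A) : ‖h.vec a‖ ≤ ‖a‖ := by
  let _ := CStarAlgebra.spectralOrder A
  have := CStarAlgebra.spectralOrderedRing A
  obtain ⟨c, hc⟩ := CStarAlgebra.nonneg_iff_eq_star_mul_self.1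
    (sub_nonneg.2 (CStarAlgebra.star_mul_le_algebraMap_norm_sq (a := a)))
  have h1 := (Complex.nonneg_iff.1 (h.nonneg c)).1
  have h2 : (algebraMap ℝ A) (‖a‖ ^ 2) = ((‖a‖ ^ 2 : ℝ) : ℂ) • (1 : A) := by
    rw [Algebra.algebraMap_eq_smul_one, Complex.coe_smul]
  rw [← hc, map_sub, h2, map_smul, h.map_one, Complex.sub_re, ← h.norm_vec_sq, smul_eq_mul, mul_one,
    Complex.ofReal_re] at h1
  exact (pow_le_pow_iff_left₀ (norm_nonneg _) (norm_nonneg _) two_ne_zero).1 (by linarith)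

theorem norm_apply_le_norm (h : IsState φ) (a : A) : ‖φ a‖ ≤ ‖a‖ := (h.norm_apply_le a).trans (h.norm_vec_le a)

theorem continuous (h : IsState φ) : Continuous φ :=
  AddMonoidHomClass.continuous_of_bound φ 1 fun a => by simpa using h.norm_apply_le_norm a

end CStar

end IsState
end

/-! ### Extension of states from the Weyl `*`-algebra to the Weyl CCR algebra. -/

noncomputable section
open scoped ComplexOrder

namespace WeylPoly

variable {V : Type*} [AddCommGroup V] [Module ℝ V] {σ : SymplecticForm V}

theorem star_gen_mul_gen (x : V) : star (gen σ x) * gen σ x = 1 := by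
  rw [star_gen, gen_mul_gen, neg_add_cancel, one_def, phase, map_neg, LinearMap.neg_apply,
    σ.self_eq_zero]
  simp

/-- Generators are unitary and act isometrically, and every element is a finite combination of them.
This is why the GNS representation consists of bounded operators before any norm is available. -/
theorem exists_norm_vec_mul_le {φ : WeylPoly σ →ₗ[ℂ] ℂ} (h : IsState φ) (f : WeylPoly σ) :
    ∃ C : ℝ, ∀ g, ‖h.vec (f * g)‖ ≤ C * ‖h.vec g‖ := by
  induction f using induction with
  | zero => exact ⟨0, fun g => by rw [zero_mul, map_zero, norm_zero, zero_mul]⟩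
  | add f f' hf hf' =>
    obtain ⟨C, hC⟩ := hf
    obtain ⟨D, hD⟩ := hf'
    refine ⟨C + D, fun g => ?_⟩
    rw [add_mul, map_add, add_mul]
    exact (norm_add_le _ _).trans (add_le_add (hC g) (hD g))
  | smul_gen a x =>
    refine ⟨‖a‖, fun g => ?_⟩
    rw [smul_mul_assoc, map_smul, norm_smul, h.norm_vec_mul_of_unitary (star_gen_mul_gen x)]

/-- Left multiplication in the GNS representation of a state on the Weyl `*`-algebra. -/
def gnsMul {φ : WeylPoly σ →ₗ[ℂ] ℂ} (h : IsState φ) (f : WeylPoly σ) :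
    h.PreGNS →L[ℂ] h.PreGNS :=
  LinearMap.mkContinuousOfExistsBound
    { toFun := fun g : WeylPoly σ => h.vec (f * g)
      map_add' := fun (g g' : WeylPoly σ) => by
        change h.vec (f * (g + g')) = _
        rw [mul_add, map_add]
      map_smul' := fun c (g : WeylPoly σ) => by
        change h.vec (f * (c • g)) = _
        rw [mul_smul_comm, map_smul]; rfl }
    (exists_norm_vec_mul_le h f)

theorem gnsMul_vec {φ : WeylPoly σ →ₗ[ℂ] ℂ} (h : IsState φ) (f g : WeylPoly σ) :
    gnsMul h f (h.vec g) = h.vec (f * g) := rfl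

/-- The operator seminorm of the GNS representation of a state on the Weyl `*`-algebra. -/
def gnsSeminorm {φ : WeylPoly σ →ₗ[ℂ] ℂ} (h : IsState φ) : Seminorm ℂ (WeylPoly σ) :=
  Seminorm.of (fun f => ‖gnsMul h f‖)
    (fun f g => by
      have : gnsMul h (f + g) = gnsMul h f + gnsMul h g := by
        ext u; exact (congrArg h.vec (add_mul f g u)).trans (map_add _ _ _)
      change ‖gnsMul h (f + g)‖ ≤ _
      rw [this]; exact norm_add_le _ _)
    (fun c f => by
      have : gnsMul h (c • f) = c • gnsMul h f := by
        ext u; exact (congrArg h.vec (smul_mul_assoc c f u)).trans (map_smul _ _ _)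
      change ‖gnsMul h (c • f)‖ = _
      rw [this, norm_smul])

theorem gnsSeminorm_apply {φ : WeylPoly σ →ₗ[ℂ] ℂ} (h : IsState φ) (f : WeylPoly σ) :
    gnsSeminorm h f = ‖gnsMul h f‖ := rfl

/-- The pre-Hilbert space need not be complete, so adjoints are avoided. Cauchy–Schwarz applied to
`⟨au, au⟩ = ⟨u, a* a u⟩` gives `p(a)² ≤ p(a* a)`. Submultiplicativity and cancellation of `p(a)`
then give `p(a) ≤ p(a*)`, from which the C*-identity follows. -/
theorem isCStarSeminorm_gnsSeminorm {φ : WeylPoly σ →ₗ[ℂ] ℂ} (h : IsState φ) :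
    IsCStarSeminorm (gnsSeminorm h) := by
  have mul_le : ∀ a b, gnsSeminorm h (a * b) ≤ gnsSeminorm h a * gnsSeminorm h b := by
    intro a b
    have : gnsMul h (a * b) = (gnsMul h a).comp (gnsMul h b) := by
      ext u; exact congrArg h.vec (mul_assoc a b u)
    rw [gnsSeminorm_apply, this]
    exact ContinuousLinearMap.opNorm_comp_le _ _
  have sq_le : ∀ a, gnsSeminorm h a ^ 2 ≤ gnsSeminorm h (star a * a) := by
    intro a
    refine (Real.le_sqrt (apply_nonneg _ _) (apply_nonneg _ _)).1 ?_
    refine ContinuousLinearMap.opNorm_le_bound _ (Real.sqrt_nonneg _) fun (u : WeylPoly σ) => ?_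
    change ‖h.vec (a * u)‖ ≤ _ * ‖h.vec u‖
    refine (pow_le_pow_iff_left₀ (norm_nonneg _) (by positivity) two_ne_zero).1 ?_
    rw [mul_pow, Real.sq_sqrt (apply_nonneg _ _), h.norm_vec_sq, star_mul, mul_assoc]
    refine (Complex.re_le_norm _).trans ((h.norm_apply_star_mul_le _ _).trans ?_)
    rw [← mul_assoc, ← gnsMul_vec, sq, ← mul_assoc, mul_comm]
    exact mul_le_mul_of_nonneg_right (ContinuousLinearMap.le_opNorm _ _) (norm_nonneg _)
  have le_star : ∀ a, gnsSeminorm h a ≤ gnsSeminorm h (star a) := by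
    intro a
    rcases (apply_nonneg (gnsSeminorm h) a).eq_or_lt with e | e
    · rw [← e]; exact apply_nonneg _ _
    · have := (sq_le a).trans (mul_le _ _)
      rw [sq] at this
      exact le_of_mul_le_mul_right this e
  refine ⟨mul_le, fun a => le_antisymm ((mul_le _ _).trans ?_) (by rw [← sq]; exact sq_le a)⟩
  refine mul_le_mul_of_nonneg_right ?_ (apply_nonneg _ _)
  simpa using le_star (star a)

/-- The GNS seminorm is one of the seminorms in the supremum defining the universal norm, and it
dominates `φ` through the cyclic unit vector `h.vec 1`. -/
theorem norm_apply_le_norm {φ : WeylPoly σ →ₗ[ℂ] ℂ} (h : IsState φ) (f : WeylPoly σ) :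
    ‖φ f‖ ≤ ‖f‖ := by
  refine (h.norm_apply_le f).trans (le_trans ?_
    (le_norm ⟨gnsSeminorm h, isCStarSeminorm_gnsSeminorm h⟩ f))
  have := (gnsMul h f).le_opNorm (h.vec 1)
  rwa [h.norm_vec_one, mul_one, gnsMul_vec, mul_one] at this

end WeylPoly

namespace WeylAlgebra

open UniformSpace

variable {V : Type*} [AddCommGroup V] [Module ℝ V] {σ : SymplecticForm V}

variable (σ) in
/-- The canonical map from the `*`-algebra of generators and relations, as a linear map. -/
def ofₗ : WeylPoly σ →ₗ[ℂ] WeylAlgebra σ where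
  toFun := of
  map_add' := of_add
  map_smul' := of_smul

/-- A state on the Weyl `*`-algebra extends to the Weyl CCR algebra. -/
theorem exists_state_extension {φ : WeylPoly σ →ₗ[ℂ] ℂ} (h : IsState φ) :
    ∃ ψ : WeylAlgebra σ →ₗ[ℂ] ℂ, IsState ψ ∧ ∀ f, ψ (of f) = φ f := by
  let φc : WeylPoly σ →L[ℂ] ℂ :=
    φ.mkContinuous 1 fun f => by simpa using WeylPoly.norm_apply_le_norm h f
  let ψ : Completion (WeylPoly σ) →L[ℂ] ℂ := φc.fromCompletion
  have hof : ∀ f : WeylPoly σ, ψ (f : Completion (WeylPoly σ)) = φ f := fun f => φc.fromCompletion_apply_coe f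
  have hψ : Continuous fun a : WeylAlgebra σ => (ψ a : ℂ) := ψ.continuous
  refine ⟨{ toFun := ψ, map_add' := ψ.map_add, map_smul' := ψ.map_smul }, ⟨?_, fun a => ?_⟩, hof⟩
  · exact (hof 1).trans h.map_one
  · refine denseRange_of.induction_on (p := fun a : WeylAlgebra σ => (0 : ℂ) ≤ ψ (star a * a)) a
      (isClosed_le continuous_const (hψ.comp (continuous_star'.mul continuous_id))) fun f => ?_
    rw [star_of, ← of_mul]
    exact (h.nonneg f).trans_eq (hof _).symm

theorem state_ext {φ ψ : WeylAlgebra σ →ₗ[ℂ] ℂ} (hφ : IsState φ) (hψ : IsState ψ)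
    (h : ∀ x, φ (w σ x) = ψ (w σ x)) : φ = ψ := by
  have e : φ ∘ₗ ofₗ σ = ψ ∘ₗ ofₗ σ := (WeylPoly.basis σ).ext fun x => h x
  refine LinearMap.ext fun a => ?_
  refine denseRange_of.induction_on a (isClosed_eq hφ.continuous hψ.continuous) fun f => ?_
  exact LinearMap.congr_fun e f

end WeylAlgebra
end

/-! ### Ordered products of exponentials: commutator and Duhamel estimates. -/

noncomputable section

section WeylProd

variable {A : Type*} [CStarAlgebra A]

/-- The ordered product `e^{i a₁} ⋯ e^{i aₖ}`. -/
def weylProd (l : List A) : A := (l.map fun a => NormedSpace.exp (Complex.I • a)).prod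

@[simp]
theorem weylProd_nil : weylProd ([] : List A) = 1 := rfl

@[simp]
theorem weylProd_cons (a : A) (l : List A) :
    weylProd (a :: l) = NormedSpace.exp (Complex.I • a) * weylProd l := rfl

theorem exp_I_smul_mem_unitary {a : A} (ha : IsSelfAdjoint a) :
    NormedSpace.exp (Complex.I • a) ∈ unitary A := by
  let _ : NormedAlgebra ℚ A := NormedAlgebra.restrictScalars ℚ ℂ A
  refine NormedSpace.exp_mem_unitary_of_mem_skewAdjoint ?_
  rw [skewAdjoint.mem_iff, star_smul, ha.star_eq, Complex.star_def, Complex.conj_I, neg_smul]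

theorem weylProd_mem_unitary {l : List A} (hl : ∀ a ∈ l, IsSelfAdjoint a) :
    weylProd l ∈ unitary A := by
  refine list_prod_mem fun u hu => ?_
  obtain ⟨a, ha, rfl⟩ := List.mem_map.1 hu
  exact exp_I_smul_mem_unitary (hl a ha)

/-- The path `s ↦ e^{(1-s)x} b e^{sx}` with `x = ia` runs from `e^x b` to `b e^x`. Its derivative is
the commutator `[b, x]` between two unitaries, so the mean value inequality applies. -/
theorem norm_commutator_exp_le (b : A) {a : A} (ha : IsSelfAdjoint a) :
    ‖b * NormedSpace.exp (Complex.I • a) - NormedSpace.exp (Complex.I • a) * b‖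
      ≤ ‖b * a - a * b‖ := by
  set x := Complex.I • a with hx
  have hu : ∀ s : ℝ, NormedSpace.exp (s • x) ∈ unitary A := fun s => by
    rw [hx, smul_comm]
    exact exp_I_smul_mem_unitary ((IsSelfAdjoint.all s).smul ha)
  have hd : ∀ s : ℝ, HasDerivAt
      (fun s : ℝ => NormedSpace.exp ((1 - s) • x) * b * NormedSpace.exp (s • x))
      (NormedSpace.exp ((1 - s) • x) * (b * x - x * b) * NormedSpace.exp (s • x)) s := by
    intro s
    have h1 : HasDerivAt (fun s : ℝ => NormedSpace.exp ((1 - s) • x))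
        (-(NormedSpace.exp ((1 - s) • x) * x)) s :=
      (hasDerivAt_exp_smul_const x (1 - s)).comp_const_sub 1 s
    refine ((h1.mul_const b).fun_mul (hasDerivAt_exp_smul_const' x s)).congr_deriv ?_
    simp only [mul_sub, sub_mul, mul_assoc, neg_mul]
    abel
  have key := norm_image_sub_le_of_norm_deriv_le_segment_01' (C := ‖b * a - a * b‖)
    (fun s _ => (hd s).hasDerivWithinAt) fun s _ => by
      rw [CStarRing.norm_mul_mem_unitary _ (hu s), CStarRing.norm_mem_unitary_mul _ (hu _), hx,
        mul_smul_comm, smul_mul_assoc, ← smul_sub, norm_smul, Complex.norm_I, one_mul]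
  simpa using key

theorem norm_commutator_weylProd_le (b : A) {l : List A} (hl : ∀ a ∈ l, IsSelfAdjoint a) :
    ‖b * weylProd l - weylProd l * b‖ ≤ (l.map fun a => ‖b * a - a * b‖).sum := by
  induction l with
  | nil => simp
  | cons a l ih =>
    have ha := hl a (by simp)
    have hl' : ∀ c ∈ l, IsSelfAdjoint c := fun c hc => hl c (by simp [hc])
    set u := NormedSpace.exp (Complex.I • a)
    have e : b * weylProd (a :: l) - weylProd (a :: l) * b
        = (b * u - u * b) * weylProd l + u * (b * weylProd l - weylProd l * b) := by
      rw [weylProd_cons]; noncomm_ring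
    rw [e, List.map_cons, List.sum_cons]
    refine (norm_add_le _ _).trans (add_le_add ?_ ?_)
    · rw [CStarRing.norm_mul_mem_unitary _ (weylProd_mem_unitary hl')]
      exact norm_commutator_exp_le b ha
    · rw [CStarRing.norm_mem_unitary_mul _ (exp_I_smul_mem_unitary ha)]
      exact ih hl'

variable {φ : A →ₗ[ℂ] ℂ}

/-- The unitary product is commuted to the left of `b`, where the GNS seminorm does not see it; the
commutator is bounded in norm. -/
theorem IsState.norm_vec_mul_weylProd_le (h : IsState φ) (b : A) {l : List A}
    (hl : ∀ a ∈ l, IsSelfAdjoint a) :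
    ‖h.vec (b * weylProd l)‖ ≤ ‖h.vec b‖ + (l.map fun a => ‖b * a - a * b‖).sum := by
  have e : b * weylProd l = weylProd l * b + (b * weylProd l - weylProd l * b) := by abel
  rw [e, map_add]
  refine (norm_add_le _ _).trans (add_le_add ?_ ?_)
  · rw [h.norm_vec_mul_of_unitary (Unitary.mem_iff.1 (weylProd_mem_unitary hl)).1]
  · exact (h.norm_vec_le _).trans (norm_commutator_weylProd_le b hl)

/-- A Duhamel estimate. -/
theorem IsState.norm_apply_exp_sub_exp_le (h : IsState φ) {u a b w : A} (hu : u ∈ unitary A)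
    (ha : IsSelfAdjoint a) {C : ℝ}
    (hC : ∀ s ∈ Set.Ico (0 : ℝ) 1,
      ‖h.vec ((a - b) * (NormedSpace.exp (Complex.I • s • b) * w))‖ ≤ C) :
    ‖φ (u * (NormedSpace.exp (Complex.I • a) - NormedSpace.exp (Complex.I • b)) * w)‖ ≤ C := by
  set x := Complex.I • a with hx
  set y := Complex.I • b with hy
  -- The path joins `e^x` to `e^y`. The factor `e^{(1-s)x}` stands on the left so that it is
  -- absorbed as a unitary, leaving only exponentials of `b` to the right of `a - b`.
  have hd : ∀ s : ℝ, HasDerivAt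
      (fun s : ℝ => NormedSpace.exp ((1 - s) • x) * NormedSpace.exp (s • y))
      (-(NormedSpace.exp ((1 - s) • x) * (x - y) * NormedSpace.exp (s • y))) s := by
    intro s
    have h1 : HasDerivAt (fun s : ℝ => NormedSpace.exp ((1 - s) • x))
        (-(NormedSpace.exp ((1 - s) • x) * x)) s :=
      (hasDerivAt_exp_smul_const x (1 - s)).comp_const_sub 1 s
    refine (h1.fun_mul (hasDerivAt_exp_smul_const' y s)).congr_deriv ?_
    simp only [mul_sub, sub_mul, mul_assoc, neg_mul]
    abel
  let φc : A →L[ℝ] ℂ := (⟨φ, h.continuous⟩ : A →L[ℂ] ℂ).restrictScalars ℝ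
  have hd' := fun s : ℝ => φc.hasFDerivAt.comp_hasDerivAt s (((hd s).const_mul u).mul_const w)
  have key := norm_image_sub_le_of_norm_deriv_le_segment_01' (C := C)
    (fun s _ => (hd' s).hasDerivWithinAt) fun s hs => by
      set v := NormedSpace.exp ((1 - s) • x) with hv
      have hvu : v ∈ unitary A := by
        rw [hv, hx, smul_comm]
        exact exp_I_smul_mem_unitary ((IsSelfAdjoint.all _).smul ha)
      have e : u * -(v * (x - y) * NormedSpace.exp (s • y)) * w
          = -(Complex.I • ((u * v) * ((a - b) * (NormedSpace.exp (s • y) * w)))) := by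
        rw [hx, hy, ← smul_sub]
        simp only [mul_smul_comm, smul_mul_assoc, mul_neg, neg_mul, mul_assoc]
      have e' : φc (u * -(v * (x - y) * NormedSpace.exp (s • y)) * w)
          = -(Complex.I • φ ((u * v) * ((a - b) * (NormedSpace.exp (s • y) * w)))) := by
        rw [e, ← map_smul, ← map_neg]; rfl
      rw [e', norm_neg, norm_smul, Complex.norm_I, one_mul]
      refine (h.norm_apply_le _).trans ?_
      rw [h.norm_vec_mul_of_unitary (Unitary.mem_iff.1 (mul_mem hu hvu)).1, hy, smul_comm]
      exact hC s hs
  simp only [Function.comp_apply, sub_self, sub_zero, zero_smul, one_smul, NormedSpace.exp_zero,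
    one_mul, mul_one] at key
  rw [mul_sub, sub_mul, map_sub, norm_sub_rev]
  exact key

/-- If `f - g` is small on the state and almost commutes with the `g`'s, then the state does not
distinguish between the ordered products of the exponentials. -/
theorem IsState.norm_weylProd_sub_le (h : IsState φ) {ι : Type*} {f g : ι → A} {δ ε : ℝ}
    {N : ℕ} {s : Set ι} (hf : ∀ i ∈ s, IsSelfAdjoint (f i)) (hg : ∀ i ∈ s, IsSelfAdjoint (g i))
    (hε : 0 ≤ ε) (hδ : ∀ i ∈ s, ‖h.vec (f i - g i)‖ ≤ δ)
    (hc : ∀ i ∈ s, ∀ j ∈ s, ‖(f i - g i) * g j - g j * (f i - g i)‖ ≤ ε)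
    (l : List ι) (hl : ∀ i ∈ l, i ∈ s) (hN : l.length ≤ N) {u : A} (hu : u ∈ unitary A) :
    ‖φ (u * weylProd (l.map f)) - φ (u * weylProd (l.map g))‖ ≤ l.length * (δ + N * ε) := by
  induction l generalizing u with
  | nil => simp
  | cons i l ih =>
    have hi : i ∈ s := hl i (by simp)
    have hl' : ∀ j ∈ l, j ∈ s := fun j hj => hl j (by simp [hj])
    simp only [List.map_cons, weylProd_cons, List.length_cons] at hN ⊢
    set x := NormedSpace.exp (Complex.I • f i)
    set y := NormedSpace.exp (Complex.I • g i)
    set P := weylProd (l.map f)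
    set R := weylProd (l.map g)
    -- Telescoping one factor at a time: the exponentials of `f` already passed join the unitary
    -- `u`, and only exponentials of `g` remain on the right. Hence only commutators with the `g j`
    -- enter.
    have e : φ (u * (x * P)) - φ (u * (y * R))
        = (φ (u * x * P) - φ (u * x * R)) + φ (u * (x - y) * R) := by
      rw [mul_sub, sub_mul, map_sub, ← mul_assoc, ← mul_assoc]; abel
    have h1 := ih hl' (by omega) (mul_mem hu (exp_I_smul_mem_unitary (hf i hi)))
    have h2 : ‖φ (u * (x - y) * R)‖ ≤ δ + N * ε := by
      refine h.norm_apply_exp_sub_exp_le hu (hf i hi) fun t ht => ?_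
      -- The partial exponential from Duhamel's formula becomes the head of an ordered product; its
      -- commutator bound only improves because `0 ≤ t < 1`.
      rw [← weylProd_cons (t • g i)]
      refine (h.norm_vec_mul_weylProd_le _ ?_).trans (add_le_add (hδ i hi) ?_)
      · intro a ha
        rcases List.mem_cons.1 ha with rfl | ha
        · exact (IsSelfAdjoint.all t).smul (hg i hi)
        · obtain ⟨j, hj, rfl⟩ := List.mem_map.1 ha
          exact hg j (hl' j hj)
      · refine (List.sum_le_card_nsmul _ ε ?_).trans ?_
        · intro r hr
          obtain ⟨a, ha, rfl⟩ := List.mem_map.1 hr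
          rcases List.mem_cons.1 ha with rfl | ha
          · rw [mul_smul_comm, smul_mul_assoc, ← smul_sub, norm_smul, Real.norm_eq_abs,
              abs_of_nonneg ht.1]
            exact (mul_le_of_le_one_left (norm_nonneg _) ht.2.le).trans (hc i hi i hi)
          · obtain ⟨j, hj, rfl⟩ := List.mem_map.1 ha
            exact hc i hi j (hl' j hj)
        · simp only [List.length_map, List.length_cons, nsmul_eq_mul]
          exact mul_le_mul_of_nonneg_right (by exact_mod_cast hN) hε
    rw [e]
    refine (norm_add_le _ _).trans ((add_le_add h1 h2).trans_eq ?_)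
    push_cast; ring

end WeylProd
end

/-! ### Locality: sums of translates, their commutators and variances, and factorisation over
blocks. -/

noncomputable section

section WeylProdLocal

variable {A : Type*} [CStarAlgebra A]

theorem exp_I_smul_mem_of_isClosed {S : StarSubalgebra ℂ A} (hS : IsClosed (S : Set A)) {a : A}
    (ha : a ∈ S) : NormedSpace.exp (Complex.I • a) ∈ S := by
  let _ : NormedAlgebra ℚ A := NormedAlgebra.restrictScalars ℚ ℂ A
  exact NormedSpace.exp_mem (R := ℂ) hS (S.smul_mem ha _)

theorem weylProd_mem_of_isClosed {S : StarSubalgebra ℂ A} (hS : IsClosed (S : Set A)) {l : List A}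
    (hl : ∀ a ∈ l, a ∈ S) : weylProd l ∈ S := by
  refine list_prod_mem fun u hu => ?_
  obtain ⟨a, ha, rfl⟩ := List.mem_map.1 hu
  exact exp_I_smul_mem_of_isClosed hS (hl a ha)

theorem Commute.weylProd_right {b : A} {l : List A} (hl : ∀ a ∈ l, Commute b a) :
    Commute b (weylProd l) := by
  let _ : NormedAlgebra ℚ A := NormedAlgebra.restrictScalars ℚ ℂ A
  refine Commute.list_prod_right _ _ fun u hu => ?_
  obtain ⟨a, ha, rfl⟩ := List.mem_map.1 hu
  exact ((hl a ha).smul_right _).exp_right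

theorem weylProd_map_add {ι : Type*} {f g : ι → A} (l : List ι)
    (h : ∀ i ∈ l, ∀ j ∈ l, Commute (f i) (g j)) :
    weylProd (l.map fun i => f i + g i) = weylProd (l.map f) * weylProd (l.map g) := by
  let _ : NormedAlgebra ℚ A := NormedAlgebra.restrictScalars ℚ ℂ A
  induction l with
  | nil => simp
  | cons i l ih =>
    have hc : Commute (NormedSpace.exp (Complex.I • g i)) (weylProd (l.map f)) := by
      refine Commute.exp_left (Commute.smul_left (Commute.weylProd_right ?_) _)
      intro a ha
      obtain ⟨j, hj, rfl⟩ := List.mem_map.1 ha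
      exact (h j (by simp [hj]) i (by simp)).symm
    have hi : Commute (Complex.I • f i) (Complex.I • g i) :=
      ((h i (by simp) i (by simp)).smul_left _).smul_right _
    simp only [List.map_cons, weylProd_cons]
    rw [ih fun i hi j hj => h i (by simp [hi]) j (by simp [hj]), smul_add,
      NormedSpace.exp_add_of_commute hi, mul_assoc, ← mul_assoc _ (weylProd (l.map f)), hc.eq]
    simp only [mul_assoc]

theorem map_weylProd (e : A ≃⋆ₐ[ℂ] A) (l : List A) : e (weylProd l) = weylProd (l.map e) := by
  let _ : NormedAlgebra ℚ A := NormedAlgebra.restrictScalars ℚ ℂ A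
  have he : Continuous e := (StarAlgEquiv.isometry e).continuous
  rw [weylProd, weylProd, map_list_prod, List.map_map, List.map_map]
  congr 2
  funext a
  simp only [Function.comp_apply]
  rw [NormedSpace.map_exp e he, map_smul]

end WeylProdLocal

/-- A double sum supported near the diagonal. -/
theorem norm_sum_sum_le_of_near_diagonal {E : Type*} [SeminormedAddCommGroup E] (G S : Finset ℤ)
    (f : ℤ → ℤ → E) (r : ℕ) {C : ℝ} (hf : ∀ i j, ‖f i j‖ ≤ C)
    (h0 : ∀ i j : ℤ, i + r ≤ j ∨ j + r ≤ i → f i j = 0) :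
    ‖∑ i ∈ G, ∑ j ∈ S, f i j‖ ≤ G.card * ((2 * r + 1) * C) := by
  have hC : 0 ≤ C := (norm_nonneg _).trans (hf 0 0)
  refine (norm_sum_le_of_le G (fun i _ => (?_ : _ ≤ (2 * r + 1) * C))).trans_eq
    (by rw [Finset.sum_const, nsmul_eq_mul])
  -- Each row has at most `2r + 1` nonzero entries whatever `S` is, so the bound depends on `G`
  -- alone.
  have e : ∑ j ∈ S, f i j = ∑ j ∈ S ∩ Finset.Icc (i - r) (i + r), f i j := by
    refine (Finset.sum_subset Finset.inter_subset_left fun j hj hj' => h0 i j ?_).symm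
    by_contra! hcon
    exact hj' (Finset.mem_inter.2 ⟨hj, Finset.mem_Icc.2 ⟨by omega, by omega⟩⟩)
  have hcard : (S ∩ Finset.Icc (i - r) (i + r)).card ≤ 2 * r + 1 := by
    refine (Finset.card_le_card Finset.inter_subset_right).trans ?_
    rw [Int.card_Icc]; omega
  rw [e]
  refine (norm_sum_le_of_le _ fun j _ => hf i j).trans ?_
  rw [Finset.sum_const, nsmul_eq_mul]
  exact mul_le_mul_of_nonneg_right (by exact_mod_cast hcard) hC

theorem Int.disjoint_Ico_of_le {a b c d : ℤ} (h : b ≤ c) :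
    Disjoint (Finset.Ico a b) (Finset.Ico c d) :=
  Finset.disjoint_left.2 fun i hi hj => by
    rw [Finset.mem_Ico] at hi hj
    omega

/-- The half-open interval `[a, b)` as a finite interval. -/
def FinInterval.ico (a b : ℤ) : FinInterval :=
  ⟨Finset.Ico a b, by rw [Finset.coe_Ico]; exact Set.ordConnected_Ico⟩

theorem FinInterval.shift_ico (a b j : ℤ) :
    (FinInterval.ico a b).shift j = FinInterval.ico (a + j) (b + j) :=
  Subtype.ext (Finset.image_add_right_Ico a b j)

section Local

variable {𝔐 : Type*} [CStarAlgebra 𝔐] {Q : QuasiLocalAlgebra 𝔐} {γ : ShiftAction Q}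

variable (Q) in
/-- The algebra of the interval `[a, b)`. -/
def QuasiLocalAlgebra.cell (a b : ℤ) : StarSubalgebra ℂ 𝔐 := Q.alg (FinInterval.ico a b)

namespace QuasiLocalAlgebra

theorem isClosed_cell (a b : ℤ) : IsClosed (Q.cell a b : Set 𝔐) := Q.isClosed _

theorem cell_mono {a b c d : ℤ} (hca : c ≤ a) (hbd : b ≤ d) : Q.cell a b ≤ Q.cell c d :=
  Q.mono _ _ (Finset.Ico_subset_Ico hca hbd)

theorem disjoint_ico {a b c d : ℤ} (h : b ≤ c) :
    Disjoint (FinInterval.ico a b).1 (FinInterval.ico c d).1 :=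
  Int.disjoint_Ico_of_le h

theorem commute_cell {a b c d : ℤ} (h : b ≤ c) {x y : 𝔐} (hx : x ∈ Q.cell a b)
    (hy : y ∈ Q.cell c d) : Commute x y :=
  Q.commute _ _ (disjoint_ico h) x hx y hy

theorem exists_mem_cell {I : FinInterval} {x : 𝔐} (hx : x ∈ Q.alg I) :
    ∃ a b, x ∈ Q.cell a b := by
  obtain ⟨a, ha⟩ := I.1.bddBelow
  obtain ⟨b, hb⟩ := I.1.bddAbove
  refine ⟨a, b + 1, Q.mono I _ (fun i hi => Finset.mem_Ico.2 ⟨ha hi, ?_⟩) hx⟩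
  exact Int.lt_add_one_of_le (hb hi)

/-- The common length `r` is the range of the interaction between translates, and later the width of
the gaps between blocks. -/
theorem exists_forall_mem_cell (l : List 𝔐) (hl : ∀ x ∈ l, ∃ I, x ∈ Q.alg I) :
    ∃ (a : ℤ) (r : ℕ), ∀ x ∈ l, x ∈ Q.cell a (a + r) := by
  induction l with
  | nil => exact ⟨0, 0, by simp⟩
  | cons x l ih =>
    obtain ⟨a, r, h⟩ := ih fun y hy => hl y (by simp [hy])
    obtain ⟨I, hI⟩ := hl x (by simp)
    obtain ⟨c, d, hx⟩ := exists_mem_cell hI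
    refine ⟨min a c, (max (a + r) d - min a c).toNat, fun y hy => ?_⟩
    rcases List.mem_cons.1 hy with rfl | hy
    · exact cell_mono (by omega) (by omega) hx
    · exact cell_mono (by omega) (by omega) (h y hy)

end QuasiLocalAlgebra

open QuasiLocalAlgebra

namespace ShiftAction

theorem aut_zero_apply (x : 𝔐) : γ.aut 0 x = x := by
  simp [aut]

theorem aut_add_apply (i j : ℤ) (x : 𝔐) : γ.aut (i + j) x = γ.aut i (γ.aut j x) := by
  simp only [aut, ofAdd_add, map_mul]; rfl

theorem norm_aut (j : ℤ) (x : 𝔐) : ‖γ.aut j x‖ = ‖x‖ := StarAlgEquiv.norm_map _ x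

theorem aut_mem_cell {a b : ℤ} {x : 𝔐} (hx : x ∈ Q.cell a b) (j : ℤ) :
    γ.aut j x ∈ Q.cell (a + j) (b + j) := by
  have h : γ.aut j x ∈ (Q.alg ((FinInterval.ico a b).shift j) : Set 𝔐) := by
    rw [← γ.map_alg]; exact ⟨x, hx, rfl⟩
  rwa [FinInterval.shift_ico] at h

end ShiftAction

variable (γ) in
/-- The sum of the translates of a local observable over a finite set. -/
def localSum (S : Finset ℤ) (x : 𝔐) : 𝔐 := ∑ j ∈ S, γ.aut j x

theorem localSum_add (S : Finset ℤ) (x y : 𝔐) :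
    localSum γ S (x + y) = localSum γ S x + localSum γ S y := by
  simp only [localSum, map_add, Finset.sum_add_distrib]

theorem localSum_zero (S : Finset ℤ) : localSum γ S (0 : 𝔐) = 0 := by
  simp [localSum]

theorem localSum_sub_of_subset {S T : Finset ℤ} (h : T ⊆ S) (x : 𝔐) :
    localSum γ S x - localSum γ T x = localSum γ (S \ T) x := by
  rw [localSum, localSum, localSum, ← Finset.sum_sdiff h, add_sub_cancel_right]

theorem localSum_union {S T : Finset ℤ} (h : Disjoint S T) (x : 𝔐) :
    localSum γ (S ∪ T) x = localSum γ S x + localSum γ T x :=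
  Finset.sum_union h

theorem localSum_image_add (S : Finset ℤ) (c : ℤ) (x : 𝔐) :
    localSum γ (S.image fun j => j + c) x = γ.aut c (localSum γ S x) := by
  rw [localSum, localSum, Finset.sum_image (by simp), map_sum]
  exact Finset.sum_congr rfl fun j _ => by rw [add_comm, γ.aut_add_apply]

theorem isSelfAdjoint_localSum (S : Finset ℤ) {x : 𝔐} (hx : IsSelfAdjoint x) :
    IsSelfAdjoint (localSum γ S x) :=
  isSelfAdjoint_sum _ fun j _ => hx.map (γ.aut j)

theorem localSum_mem_cell {S : Finset ℤ} {c d a : ℤ} {r : ℕ} (hS : S ⊆ Finset.Ico c d) {x : 𝔐}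
    (hx : x ∈ Q.cell a (a + r)) : localSum γ S x ∈ Q.cell (a + c) (a + d + r) := by
  refine sum_mem fun j hj => ?_
  have := Finset.mem_Ico.1 (hS hj)
  exact cell_mono (by omega) (by omega) (γ.aut_mem_cell hx j)

/-- Only pairs of translates at distance less than `r` fail to commute. The bound is linear in `|G|`
and independent of `S`, so after scaling by `1/N` it is governed by the density of `G`. -/
theorem norm_commutator_localSum_le (G S : Finset ℤ) {a : ℤ} {r : ℕ} {x y : 𝔐}
    (hx : x ∈ Q.cell a (a + r)) (hy : y ∈ Q.cell a (a + r)) :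
    ‖localSum γ G x * localSum γ S y - localSum γ S y * localSum γ G x‖
      ≤ G.card * ((2 * r + 1) * (2 * ‖x‖ * ‖y‖)) := by
  have e : localSum γ G x * localSum γ S y - localSum γ S y * localSum γ G x
      = ∑ i ∈ G, ∑ j ∈ S, (γ.aut i x * γ.aut j y - γ.aut j y * γ.aut i x) := by
    simp only [localSum, Finset.sum_sub_distrib, Finset.sum_mul_sum]
    rw [Finset.sum_comm (s := S)]
  rw [e]
  refine norm_sum_sum_le_of_near_diagonal G S _ r (fun i j => ?_) fun i j hij => ?_
  · refine (norm_sub_le _ _).trans ?_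
    have h1 := norm_mul_le (γ.aut i x) (γ.aut j y)
    have h2 := norm_mul_le (γ.aut j y) (γ.aut i x)
    rw [γ.norm_aut, γ.norm_aut] at h1 h2
    linarith
  · rw [sub_eq_zero]
    rcases hij with h | h
    · exact commute_cell (by omega) (γ.aut_mem_cell hx i) (γ.aut_mem_cell hy j)
    · exact (commute_cell (by omega) (γ.aut_mem_cell hy j) (γ.aut_mem_cell hx i)).symm

variable (χ : InvMultState γ)

namespace InvMultState

theorem apply_mul_of_mem_cell {a b c d : ℤ} (h : b ≤ c ∨ d ≤ a) {x y : 𝔐} (hx : x ∈ Q.cell a b)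
    (hy : y ∈ Q.cell c d) : χ.toFun (x * y) = χ.toFun x * χ.toFun y := by
  refine χ.multiplicative _ _ ?_ x hx y hy
  rcases h with h | h
  · exact disjoint_ico h
  · exact (disjoint_ico h).symm

/-- Distant pairs contribute `χ(x)² = 0`, so the variance grows only linearly in `|G|`, while the
triangle inequality for the norm would give a quadratic bound. -/
theorem norm_vec_localSum_sq_le (G : Finset ℤ) {a : ℤ} {r : ℕ} {x : 𝔐}
    (hx : x ∈ Q.cell a (a + r)) (hsa : IsSelfAdjoint x) (h0 : χ.toFun x = 0) :
    ‖χ.isState.vec (localSum γ G x)‖ ^ 2 ≤ G.card * ((2 * r + 1) * (‖x‖ * ‖x‖)) := by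
  rw [χ.isState.norm_vec_sq, (isSelfAdjoint_localSum G hsa).star_eq]
  refine (Complex.re_le_norm _).trans ?_
  rw [localSum, Finset.sum_mul_sum]
  simp only [map_sum]
  refine norm_sum_sum_le_of_near_diagonal G G _ r (fun i j => ?_) fun i j hij => ?_
  · refine (χ.isState.norm_apply_le_norm _).trans ((norm_mul_le _ _).trans ?_)
    rw [γ.norm_aut, γ.norm_aut]
  · rw [χ.apply_mul_of_mem_cell (by omega) (γ.aut_mem_cell hx i) (γ.aut_mem_cell hx j),
      χ.invariant, h0, zero_mul]

theorem apply_weylProd_localSum_image_add (S : Finset ℤ) (c : ℤ) (t : ℝ) (l : List 𝔐) :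
    χ.toFun (weylProd (l.map fun x => t • localSum γ (S.image fun j => j + c) x))
      = χ.toFun (weylProd (l.map fun x => t • localSum γ S x)) := by
  rw [← χ.invariant c (weylProd (l.map fun x => t • localSum γ S x)), map_weylProd,
    List.map_map]
  congr 3
  funext x
  rw [Function.comp_apply, localSum_image_add, ← Complex.coe_smul, ← Complex.coe_smul, map_smul]

/-- A gap of width `r` places the two local sums in disjoint cells. Cells are norm closed, so the
exponentials stay in them; commutation separates the two products and multiplicativity of `χ` splits
the expectation. -/
theorem apply_weylProd_localSum_union {S T : Finset ℤ} {c d e f a : ℤ} {r : ℕ}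
    (hS : S ⊆ Finset.Ico c d) (hT : T ⊆ Finset.Ico e f) (hde : d + r ≤ e) (t : ℝ) (l : List 𝔐)
    (hl : ∀ x ∈ l, x ∈ Q.cell a (a + r)) :
    χ.toFun (weylProd (l.map fun x => t • localSum γ (S ∪ T) x))
      = χ.toFun (weylProd (l.map fun x => t • localSum γ S x))
        * χ.toFun (weylProd (l.map fun x => t • localSum γ T x)) := by
  have hST : Disjoint S T :=
    (Int.disjoint_Ico_of_le (by omega)).mono hS hT
  have hmS : ∀ x ∈ l, t • localSum γ S x ∈ Q.cell (a + c) (a + d + r) := fun x hx => by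
    rw [← Complex.coe_smul]
    exact StarSubalgebra.smul_mem _ (localSum_mem_cell hS (hl x hx)) _
  have hmT : ∀ x ∈ l, t • localSum γ T x ∈ Q.cell (a + e) (a + f + r) := fun x hx => by
    rw [← Complex.coe_smul]
    exact StarSubalgebra.smul_mem _ (localSum_mem_cell hT (hl x hx)) _
  simp only [localSum_union hST, smul_add]
  rw [weylProd_map_add l fun x hx y hy => commute_cell (by omega) (hmS x hx) (hmT y hy)]
  refine χ.apply_mul_of_mem_cell (a := a + c) (b := a + d + r) (c := a + e) (d := a + f + r)
    (by omega) (weylProd_mem_of_isClosed (isClosed_cell _ _) ?_)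
    (weylProd_mem_of_isClosed (isClosed_cell _ _) ?_)
  · intro z hz
    obtain ⟨x, hx, rfl⟩ := List.mem_map.1 hz
    exact hmS x hx
  · intro z hz
    obtain ⟨x, hx, rfl⟩ := List.mem_map.1 hz
    exact hmT x hx

end InvMultState

/-- The union of the `m` blocks `[b q, b q + L)`, `b < m`. -/
def blocks (q L m : ℕ) : Finset ℤ :=
  (Finset.range m).biUnion fun b => Finset.Ico ((b * q : ℕ) : ℤ) ((b * q + L : ℕ) : ℤ)

theorem blocks_succ (q L m : ℕ) :
    blocks q L (m + 1)
      = blocks q L m ∪ (Finset.Ico (0 : ℤ) L).image fun j => j + ((m * q : ℕ) : ℤ) := by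
  rw [blocks, blocks, Finset.range_add_one, Finset.biUnion_insert, Finset.union_comm,
    Finset.image_add_right_Ico]
  congr 2 <;> push_cast <;> ring

/-- The spare `r` at the right end is the gap before the next block, which starts at `m * q`. -/
theorem blocks_subset (q r L m : ℕ) (h : L + r ≤ q) :
    blocks q L m ⊆ Finset.Ico (0 : ℤ) (((m * q : ℕ) : ℤ) - r) := by
  intro j hj
  simp only [blocks, Finset.mem_biUnion, Finset.mem_range, Finset.mem_Ico] at hj ⊢
  obtain ⟨b, hb, h1, h2⟩ := hj
  have : (b + 1) * q ≤ m * q := Nat.mul_le_mul_right q hb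
  rw [add_mul, one_mul] at this
  omega

theorem card_blocks (q L m : ℕ) (h : L ≤ q) : (blocks q L m).card = m * L := by
  induction m with
  | zero => simp [blocks]
  | succ m ih =>
    rw [blocks_succ, Finset.card_union_of_disjoint, ih, Finset.image_add_right_Ico, Int.card_Ico,
      add_mul, one_mul]
    · omega
    · refine Finset.disjoint_of_subset_left (blocks_subset q 0 L m (by omega)) ?_
      rw [Finset.image_add_right_Ico]
      exact Int.disjoint_Ico_of_le (by simp)

/-- Separated blocks are independent, and by invariance each has the same expectation as `[0, L)`.
No error term arises here. -/
theorem InvMultState.apply_weylProd_localSum_blocks (r L m : ℕ) {a : ℤ} (t : ℝ) (l : List 𝔐)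
    (hl : ∀ x ∈ l, x ∈ Q.cell a (a + r)) :
    χ.toFun (weylProd (l.map fun x => t • localSum γ (blocks (L + r) L m) x))
      = χ.toFun (weylProd (l.map fun x => t • localSum γ (Finset.Ico 0 (L : ℤ)) x)) ^ m := by
  induction m with
  | zero =>
    have e : ∀ x, t • localSum γ (blocks (L + r) L 0) x = (0 : 𝔐) := fun x => by
      simp [blocks, localSum]
    have : ∀ l : List 𝔐, weylProd (l.map fun _ => (0 : 𝔐)) = 1 := fun l => by
      induction l with
      | nil => rfl
      | cons x l ih => rw [List.map_cons, weylProd_cons, ih]; simp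
    simp only [e, this, pow_zero, χ.isState.map_one]
  | succ m ih =>
    rw [pow_succ, ← ih, blocks_succ,
      χ.apply_weylProd_localSum_union (blocks_subset (L + r) r L m le_rfl)
        (Finset.image_add_right_Ico _ _ _).subset (by omega) t l hl,
      χ.apply_weylProd_localSum_image_add]

end Local
end

/-! ### Second-order expansion and scalar limits. -/

noncomputable section

open Filter Topology Asymptotics

section Taylor

variable {A : Type*} [CStarAlgebra A]

/-- The (negative of the) second order coefficient of `e^{i t a₁} ⋯ e^{i t aₖ}`. -/
def weylQuad : List A → A
  | [] => 0
  | a :: l => (1 / 2 : ℝ) • (a * a) + a * l.sum + weylQuad l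

theorem exp_I_smul_sub_isBigO (a : A) :
    (fun t : ℝ => NormedSpace.exp (Complex.I • t • a)
      - (1 + t • (Complex.I • a) - t ^ 2 • ((1 / 2 : ℝ) • (a * a)))) =O[𝓝 0] fun t => t ^ 3 := by
  have h := (NormedSpace.exp_hasFPowerSeriesAt_zero (𝕂 := ℂ) (𝔸 := A)).isBigO_sub_partialSum_pow 3
  have ht : Tendsto (fun t : ℝ => t • (Complex.I • a)) (𝓝 0) (𝓝 0) := by
    have : Continuous fun t : ℝ => t • (Complex.I • a) := by fun_prop
    simpa using this.tendsto 0
  refine ((h.comp_tendsto ht).congr' ?_ EventuallyEq.rfl).trans ?_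
  · refine Eventually.of_forall fun t => ?_
    simp only [Function.comp_apply, zero_add, FormalMultilinearSeries.partialSum,
      Finset.sum_range_succ, Finset.sum_range_zero, NormedSpace.expSeries_apply_eq']
    rw [smul_comm Complex.I t a]
    congr 1
    have e : (t • Complex.I • a) ^ 2 = -(t ^ 2 • (a * a)) := by
      rw [smul_pow, smul_pow, Complex.I_sq, neg_smul, one_smul, smul_neg, sq a]
    rw [e]
    simp only [Nat.factorial, pow_zero, pow_one]
    rw [smul_comm (t ^ 2) (1 / 2 : ℝ), ← Complex.coe_smul (1 / 2 : ℝ)]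
    norm_num
    rw [sub_eq_add_neg]
  · refine IsBigO.of_bound (‖Complex.I • a‖ ^ 3) (Eventually.of_forall fun t => ?_)
    simp only [Function.comp_apply, norm_pow, norm_norm]
    rw [norm_smul, mul_pow, mul_comm]

theorem weylProd_smul_sub_isBigO (l : List A) :
    (fun t : ℝ => weylProd (l.map fun a => t • a)
      - (1 + t • (Complex.I • l.sum) - t ^ 2 • weylQuad l)) =O[𝓝 0] fun t => t ^ 3 := by
  induction l with
  | nil =>
    refine (isBigO_zero _ _).congr_left fun t => ?_
    simp [weylQuad]
  | cons a l ih =>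
    set b := Complex.I • a with hb
    set c := (1 / 2 : ℝ) • (a * a) with hc
    set d := Complex.I • l.sum with hd
    set q := weylQuad l
    have h1 : (fun t : ℝ => NormedSpace.exp (Complex.I • t • a) - (1 + t • b - t ^ 2 • c))
        =O[𝓝 0] fun t => t ^ 3 := exp_I_smul_sub_isBigO a
    have e1 : (fun t : ℝ => NormedSpace.exp (Complex.I • t • a)) =O[𝓝 0] fun _ => (1 : ℝ) := by
      have : Continuous fun t : ℝ => NormedSpace.exp (Complex.I • t • a) := by
        let _ : NormedAlgebra ℚ A := NormedAlgebra.restrictScalars ℚ ℂ A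
        exact NormedSpace.exp_continuous.comp (by fun_prop)
      exact (this.tendsto 0).isBigO_one ℝ
    have e2 : (fun t : ℝ => 1 + t • d - t ^ 2 • q) =O[𝓝 0] fun _ => (1 : ℝ) := by
      have : Continuous fun t : ℝ => 1 + t • d - t ^ 2 • q := by fun_prop
      exact (this.tendsto 0).isBigO_one ℝ
    -- These are the terms of order three and four in the product of the quadratic polynomials `1 +
    -- tb - t²c` and `1 + td - t²q`.
    have e3 : (fun t : ℝ => t ^ 3 • (t • (c * q) - (b * q + c * d))) =O[𝓝 0]
        fun t : ℝ => t ^ 3 := by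
      have : Continuous fun t : ℝ => t • (c * q) - (b * q + c * d) := by fun_prop
      have := (isBigO_refl (fun t : ℝ => t ^ 3) (𝓝 0)).smul ((this.tendsto 0).isBigO_one ℝ)
      simpa using this
    have h2 := e1.mul ih
    have h3 := h1.mul e2
    simp only [one_mul, mul_one] at h2 h3
    refine ((h2.add h3).add e3).congr_left fun t => ?_
    have hbd : b * d = -(a * l.sum) := by
      rw [hb, hd, smul_mul_smul_comm, Complex.I_mul_I, neg_smul, one_smul]
    have hq : weylQuad (a :: l) = c - b * d + q := by
      rw [hbd, weylQuad, sub_neg_eq_add]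
    rw [hq, List.map_cons, weylProd_cons, List.sum_cons, smul_add Complex.I, ← hb, ← hd]
    set E := NormedSpace.exp (Complex.I • t • a)
    set P := weylProd (l.map fun a => t • a)
    simp only [mul_sub, sub_mul, mul_add, add_mul, smul_sub, smul_add, mul_smul_comm,
      smul_mul_assoc, mul_one, one_mul, smul_smul]
    module

variable {φ : A →ₗ[ℂ] ℂ}

/-- Centring kills the first-order term, which is what makes the scale `t = N^{-1/2}` the right one.
-/
theorem IsState.apply_weylProd_smul_isLittleO (h : IsState φ) (l : List A) (hl : φ l.sum = 0) :
    (fun t : ℝ => φ (weylProd (l.map fun a => t • a)) - 1 + (t ^ 2 : ℝ) * φ (weylQuad l))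
      =o[𝓝 0] fun t => t ^ 2 := by
  have h0 : (fun t : ℝ => t ^ 3) =o[𝓝 0] fun t => t ^ 2 :=
    isLittleO_pow_pow (by norm_num)
  refine IsBigO.trans_isLittleO ?_ h0
  let φc : A →L[ℂ] ℂ := ⟨φ, h.continuous⟩
  refine ((φc.isBigO_comp _ _).trans (weylProd_smul_sub_isBigO l)).congr_left fun t => ?_
  change φ _ = _
  rw [map_sub, map_sub, map_add, h.map_one, ← Complex.coe_smul, ← Complex.coe_smul, map_smul,
    map_smul, map_smul, hl, smul_zero, smul_zero, add_zero, smul_eq_mul]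
  ring

end Taylor

theorem tendsto_nat_div_div (q : ℕ) (hq : 0 < q) :
    Tendsto (fun N : ℕ => ((N / q : ℕ) : ℝ) / N) atTop (𝓝 (1 / q)) := by
  have h := (tendsto_nat_floor_mul_div_atTop (R := ℝ) (a := 1 / q) (by positivity)).comp
    tendsto_natCast_atTop_atTop
  refine h.congr fun N => ?_
  simp only [Function.comp_apply]
  rw [one_div_mul_eq_div, Nat.floor_div_natCast, Nat.floor_natCast]

/-- With `t² = 1/N` the expansion says `N (z - 1) → -κ`, hence `N log z → -κ`. The exponent `N / q`
is asymptotic to `N` times `1 / q`. -/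
theorem tendsto_pow_nat_div_exp {z : ℝ → ℂ} {κ : ℂ}
    (hz : (fun t : ℝ => z t - 1 + (t ^ 2 : ℝ) * κ) =o[𝓝 0] fun t => t ^ 2) (q : ℕ) (hq : 0 < q) :
    Tendsto (fun N : ℕ => z (Real.sqrt N)⁻¹ ^ (N / q)) atTop (𝓝 (Complex.exp (-(κ / q)))) := by
  have ht : Tendsto (fun N : ℕ => (Real.sqrt N)⁻¹) atTop (𝓝 0) :=
    (Real.tendsto_sqrt_atTop.comp tendsto_natCast_atTop_atTop).inv_tendsto_atTop
  have hz' : (fun t : ℝ => z t - 1 + (t ^ 2 : ℝ) * κ) =o[𝓝 0] fun t => ((t ^ 2 : ℝ) : ℂ) :=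
    hz.trans_isBigO (IsBigO.of_bound 1 (Eventually.of_forall fun t => by
      rw [one_mul, Complex.norm_real]))
  have h1 : Tendsto (fun N : ℕ => (N : ℂ) * (z (Real.sqrt N)⁻¹ - 1)) atTop (𝓝 (-κ)) := by
    have h2 := (hz'.tendsto_div_nhds_zero.comp ht).sub_const κ
    rw [zero_sub] at h2
    refine h2.congr' ?_
    filter_upwards [eventually_gt_atTop 0] with N hN
    have hN' : (N : ℂ) ≠ 0 := by exact_mod_cast hN.ne'
    simp only [Function.comp_apply, inv_pow, Real.sq_sqrt (Nat.cast_nonneg N)]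
    push_cast
    field_simp
    ring
  have hlog := Complex.tendsto_nat_mul_log_one_add_of_tendsto h1
  simp only [add_sub_cancel] at hlog
  have hne : ∀ᶠ N : ℕ in atTop, z (Real.sqrt N)⁻¹ ≠ 0 := by
    have hz1 : Tendsto (fun N : ℕ => z (Real.sqrt N)⁻¹ - 1) atTop (𝓝 0) := by
      have h3 : Tendsto (fun N : ℕ => (N : ℂ)⁻¹) atTop (𝓝 0) :=
        tendsto_inv_atTop_nhds_zero_nat
      have h4 := h3.mul h1
      rw [zero_mul] at h4
      refine h4.congr' ?_
      filter_upwards [eventually_gt_atTop 0] with N hN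
      have hN' : (N : ℂ) ≠ 0 := by exact_mod_cast hN.ne'
      rw [inv_mul_cancel_left₀ hN']
    filter_upwards [hz1.eventually_ne (b₂ := -1) (by norm_num)] with N hN h0
    exact hN (by rw [h0, zero_sub])
  have hdiv : Tendsto (fun N : ℕ => ((((N / q : ℕ) : ℝ) / N : ℝ) : ℂ)) atTop
      (𝓝 ((1 / q : ℝ) : ℂ)) :=
    (Complex.continuous_ofReal.tendsto _).comp (tendsto_nat_div_div q hq)
  have hfin := (Complex.continuous_exp.tendsto _).comp (hdiv.mul hlog)
  have e : ((1 / q : ℝ) : ℂ) * -κ = -(κ / q) := by push_cast; ring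
  rw [e] at hfin
  refine hfin.congr' ?_
  filter_upwards [hne, eventually_gt_atTop 0] with N hN hN0
  have hN' : (N : ℂ) ≠ 0 := by exact_mod_cast hN0.ne'
  simp only [Function.comp_apply]
  nth_rewrite 2 [← Complex.exp_log hN]
  rw [← Complex.exp_nat_mul]
  congr 1
  push_cast
  field_simp

/-- Averages of a summable function over the differences of the points of `[0, L)`. -/
theorem tendsto_sum_sum_sub_div {f : ℤ → ℂ} (hf : Summable f) (r : ℕ) :
    Tendsto (fun L : ℕ => (∑ i ∈ Finset.Ico (0 : ℤ) L, ∑ j ∈ Finset.Ico (0 : ℤ) L, f (j - i))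
      / ((L + r : ℕ) : ℂ)) atTop (𝓝 (∑' k, f k)) := by
  let u : ℕ → ℂ := fun n => ∑ k ∈ Finset.Icc (-(n : ℤ)) n, f k
  have hu : Tendsto u atTop (𝓝 (∑' k, f k)) := by
    refine hf.hasSum.comp (tendsto_atTop_finset_of_monotone ?_ ?_)
    · intro m n hmn
      exact Finset.Icc_subset_Icc (by omega) (by omega)
    · intro k
      exact ⟨k.natAbs, Finset.mem_Icc.2 ⟨by omega, by omega⟩⟩
  -- Enlarging the square from side `L` to `L + 1` adds a row, a column and a corner, whose total is
  -- the symmetric partial sum `u L`. The double sum over `L` is thus a Cesàro mean of partial sums;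
  -- replacing `L` by `L + r` in the denominator does not change the limit.
  have hsum : ∀ L : ℕ, ∑ i ∈ Finset.Ico (0 : ℤ) L, ∑ j ∈ Finset.Ico (0 : ℤ) L, f (j - i)
      = ∑ n ∈ Finset.range L, u n := by
    intro L
    induction L with
    | zero => simp
    | succ L ih =>
      have hins : Finset.Ico (0 : ℤ) ((L + 1 : ℕ) : ℤ) = insert (L : ℤ) (Finset.Ico (0 : ℤ) L) := by
        ext k; simp only [Finset.mem_Ico, Finset.mem_insert]; omega
      have hnot : (L : ℤ) ∉ Finset.Ico (0 : ℤ) L := by simp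
      have hrow : ∑ j ∈ Finset.Ico (0 : ℤ) L, f (j - L) = ∑ k ∈ Finset.Ico (-(L : ℤ)) 0, f k := by
        refine Finset.sum_nbij' (· - (L : ℤ)) (· + (L : ℤ)) ?_ ?_ ?_ ?_ ?_ <;>
          simp only [Finset.mem_Ico] <;> intros <;> first | omega | rfl | trivial
      have hcol : ∑ i ∈ Finset.Ico (0 : ℤ) L, f (L - i) = ∑ k ∈ Finset.Ioc (0 : ℤ) L, f k := by
        refine Finset.sum_nbij' ((L : ℤ) - ·) ((L : ℤ) - ·) ?_ ?_ ?_ ?_ ?_ <;>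
          simp only [Finset.mem_Ico, Finset.mem_Ioc] <;> intros <;> first | omega | rfl | trivial
      have huL : u L = f 0 + ∑ k ∈ Finset.Ico (-(L : ℤ)) 0, f k
          + ∑ k ∈ Finset.Ioc (0 : ℤ) L, f k := by
        have : Finset.Icc (-(L : ℤ)) L
            = insert 0 (Finset.Ico (-(L : ℤ)) 0) ∪ Finset.Ioc (0 : ℤ) L := by
          ext k
          simp only [Finset.mem_Icc, Finset.mem_union, Finset.mem_insert, Finset.mem_Ico,
            Finset.mem_Ioc]
          omega
        change ∑ k ∈ Finset.Icc (-(L : ℤ)) L, f k = _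
        rw [this, Finset.sum_union, Finset.sum_insert (by simp)]
        refine Finset.disjoint_left.2 fun k hk hk' => ?_
        simp only [Finset.mem_insert, Finset.mem_Ico, Finset.mem_Ioc] at hk hk'
        omega
      rw [Finset.sum_range_succ, ← ih, huL, hins, Finset.sum_insert hnot, Finset.sum_insert hnot,
        hrow, ← hcol, sub_self]
      simp only [Finset.sum_insert hnot, Finset.sum_add_distrib]
      ring
  have h1 := hu.cesaro_smul
  have h2 : Tendsto (fun L : ℕ => ((L : ℝ) / (L + r : ℕ) : ℝ)) atTop (𝓝 1) := by
    have := tendsto_natCast_div_add_atTop (𝕜 := ℝ) (r : ℝ)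
    refine this.congr fun L => by push_cast; rfl
  have h3 := h2.smul h1
  rw [one_smul] at h3
  refine h3.congr' ?_
  filter_upwards [eventually_gt_atTop 0] with L hL
  have hL' : (L : ℂ) ≠ 0 := by exact_mod_cast hL.ne'
  rw [hsum, smul_smul, ← Complex.coe_smul, smul_eq_mul]
  push_cast
  field_simp

end

/-! ### The complex covariance and Gaussian values on products of Weyl generators. -/

noncomputable section

open Filter Topology

section Covariance

variable {𝔐 : Type*} [CStarAlgebra 𝔐] {Q : QuasiLocalAlgebra 𝔐} {γ : ShiftAction Q}
  (χ : InvMultState γ)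

/-- The complex covariance `∑_k (χ(x γ_k(y)) - χ(x) χ(y))`, equal to `s_χ - i σ_χ`. -/
def cov (x y : Q.localSA) : ℂ := ∑' k : ℤ, corr χ (x : 𝔐) (y : 𝔐) k

theorem sForm_eq_re_cov (x y : Q.localSA) : sForm χ x y = (cov χ x y).re := rfl

theorem sigmaForm_eq_neg_im_cov (x y : Q.localSA) :
    (sigmaForm χ).toBilin x y = -(cov χ x y).im := rfl

theorem cov_add_left (x x' y : Q.localSA) : cov χ (x + x') y = cov χ x y + cov χ x' y := by
  rw [cov, cov, cov, ← (corr_summable χ x y).tsum_add (corr_summable χ x' y)]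
  refine tsum_congr fun k => ?_
  simp only [corr, Submodule.coe_add, add_mul, map_add]; ring

theorem cov_add_right (x y y' : Q.localSA) : cov χ x (y + y') = cov χ x y + cov χ x y' := by
  rw [cov, cov, cov, ← (corr_summable χ x y).tsum_add (corr_summable χ x y')]
  refine tsum_congr fun k => ?_
  simp only [corr, Submodule.coe_add, map_add, mul_add]; ring

theorem star_corr {x y : 𝔐} (hx : IsSelfAdjoint x) (hy : IsSelfAdjoint y) (k : ℤ) :
    star (corr χ x y k) = corr χ y x (-k) := by
  simp only [corr]
  rw [star_sub, star_mul', ← χ.isState.map_star, ← χ.isState.map_star, ← χ.isState.map_star,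
    star_mul, ← map_star (γ.aut k), hx.star_eq, hy.star_eq, ← χ.invariant (-k), map_mul,
    ← γ.aut_add_apply, neg_add_cancel, γ.aut_zero_apply, mul_comm (χ.toFun y)]

theorem star_cov (x y : Q.localSA) : star (cov χ x y) = cov χ y x := by
  rw [cov, tsum_star, tsum_congr (star_corr χ x.2.1 y.2.1)]
  exact (Equiv.neg ℤ).tsum_eq (corr χ (y : 𝔐) (x : 𝔐))

theorem cov_zero_left (y : Q.localSA) : cov χ 0 y = 0 := by
  simpa using cov_add_left χ 0 0 y

/-- The exponent of the quasi-free state on a product of Weyl elements, up to its sign. -/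
def covQuad : List Q.localSA → ℂ
  | [] => 0
  | x :: l => 1 / 2 * cov χ x x + cov χ x l.sum + covQuad l

/-- Since `cov` is Hermitian, the exponent equals `i ∑_{j<k} σ(x_j, x_k)`, the sum of the phases
accumulated from the Weyl relations. -/
theorem prod_gen (l : List Q.localSA) :
    (l.map (WeylPoly.gen (sigmaForm χ))).prod
      = Complex.exp (cov χ l.sum l.sum / 2 - covQuad χ l) • WeylPoly.gen (sigmaForm χ) l.sum := by
  induction l with
  | nil => simp [covQuad, cov_zero_left, WeylPoly.one_def]
  | cons x l ih =>
    rw [List.map_cons, List.prod_cons, ih, mul_smul_comm, WeylPoly.gen_mul_gen, smul_smul,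
      WeylPoly.phase, ← Complex.exp_add, List.sum_cons, covQuad, sigmaForm_eq_neg_im_cov]
    congr 2
    have h1 : cov χ l.sum x = star (cov χ x l.sum) := (star_cov χ _ _).symm
    rw [cov_add_left, cov_add_right, cov_add_right, h1]
    apply Complex.ext <;> simp <;> ring

theorem cov_self_im (x : Q.localSA) : (cov χ x x).im = 0 := by
  have := (sigmaForm χ).self_eq_zero x
  rwa [sigmaForm_eq_neg_im_cov, neg_eq_zero] at this

/-- The Gaussian factor contributes `-cov(Σ, Σ)/2`, where `Σ` is the sum of the list and `cov(Σ, Σ)`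
is real. It cancels the same term in the phase and leaves `-covQuad`. -/
theorem apply_prod_gen {φ : WeylPoly (sigmaForm χ) →ₗ[ℂ] ℂ}
    (h : ∀ x, φ (WeylPoly.gen _ x) = (Real.exp (-(sForm χ x x) / 2) : ℂ)) (l : List Q.localSA) :
    φ (l.map (WeylPoly.gen (sigmaForm χ))).prod = Complex.exp (-covQuad χ l) := by
  have e : cov χ l.sum l.sum = (sForm χ l.sum l.sum : ℂ) := by
    apply Complex.ext
    · simp [sForm_eq_re_cov]
    · simp [cov_self_im]
  rw [prod_gen, map_smul, h, smul_eq_mul, Complex.ofReal_exp, ← Complex.exp_add, e]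
  congr 1
  push_cast
  ring

/-- The self-adjoint local observable `x - χ(x) 1`. -/
def center : Q.localSA →+ Q.localSA where
  toFun x := ⟨x - χ.toFun x • (1 : 𝔐), by
    obtain ⟨hx, I, hI⟩ := x.2
    refine ⟨hx.sub ?_, I, sub_mem hI ((Q.alg I).smul_mem (one_mem _) _)⟩
    rw [IsSelfAdjoint, star_smul, star_one, ← χ.isState.map_star, hx.star_eq]⟩
  map_zero' := by ext; simp
  map_add' x y := by
    ext
    simp only [Submodule.coe_add, map_add, add_smul]
    abel

theorem coe_center (x : Q.localSA) : (center χ x : 𝔐) = x - χ.toFun x • (1 : 𝔐) := rfl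

theorem apply_center (x : Q.localSA) : χ.toFun (center χ x : 𝔐) = 0 := by
  rw [coe_center, map_sub, map_smul, χ.isState.map_one, smul_eq_mul, mul_one, sub_self]

theorem cov_center (x y : Q.localSA) : cov χ (center χ x) (center χ y) = cov χ x y := by
  refine tsum_congr fun k => ?_
  rw [corr, corr, apply_center, zero_mul, sub_zero, coe_center, coe_center, map_sub, map_smul,
    map_one, mul_sub, sub_mul, sub_mul, mul_smul_comm, mul_one, smul_mul_assoc, one_mul,
    mul_smul_comm, mul_one]
  simp only [map_sub, map_smul, χ.invariant, χ.isState.map_one, smul_eq_mul]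
  ring

theorem covQuad_map_center (l : List Q.localSA) :
    covQuad χ (l.map (center χ)) = covQuad χ l := by
  induction l with
  | nil => rfl
  | cons x l ih =>
    rw [List.map_cons, covQuad, covQuad, ih, ← map_list_sum, cov_center, cov_center]

theorem fluctuation_eq (I : FinInterval) (x : Q.localSA) :
    fluctuation χ I (x : 𝔐) = (Real.sqrt I.1.card)⁻¹ • localSum γ I.1 (center χ x : 𝔐) := by
  rw [fluctuation, Complex.coe_smul, localSum, coe_center]
  congr 1
  refine Finset.sum_congr rfl fun j _ => ?_
  rw [map_sub, map_smul, map_one]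

theorem sum_map_localSum (S : Finset ℤ) (l : List Q.localSA) :
    (l.map fun x : Q.localSA => localSum γ S (x : 𝔐)).sum = localSum γ S (l.sum : Q.localSA) := by
  induction l with
  | nil => simp [localSum_zero]
  | cons x l ih =>
    rw [List.map_cons, List.sum_cons, ih, List.sum_cons, Submodule.coe_add, localSum_add]

theorem apply_localSum (S : Finset ℤ) {x : 𝔐} (hx : χ.toFun x = 0) :
    χ.toFun (localSum γ S x) = 0 := by
  rw [localSum, map_sum]
  exact Finset.sum_eq_zero fun j _ => by rw [χ.invariant, hx]

theorem tendsto_apply_localSum_mul_div (r : ℕ) {x y : Q.localSA} (hx : χ.toFun (x : 𝔐) = 0) :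
    Tendsto (fun L : ℕ => χ.toFun (localSum γ (Finset.Ico 0 (L : ℤ)) (x : 𝔐)
      * localSum γ (Finset.Ico 0 (L : ℤ)) (y : 𝔐)) / ((L + r : ℕ) : ℂ)) atTop
      (𝓝 (cov χ x y)) := by
  refine (tendsto_sum_sum_sub_div (corr_summable χ x y) r).congr fun L => ?_
  congr 1
  rw [localSum, localSum, Finset.sum_mul_sum, map_sum]
  refine Finset.sum_congr rfl fun i _ => ?_
  rw [map_sum]
  refine Finset.sum_congr rfl fun j _ => ?_
  -- Translating by `i` turns `χ(x γ_{j-i}(y))` into `χ(γ_i(x) γ_j(y))`.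
  rw [corr, hx, zero_mul, sub_zero, ← χ.invariant i ((x : 𝔐) * _), map_mul, ← γ.aut_add_apply,
    add_sub_cancel]

theorem apply_list_sum_eq_zero {l : List Q.localSA} (hl : ∀ x ∈ l, χ.toFun (x : 𝔐) = 0) :
    χ.toFun (l.sum : Q.localSA) = 0 := by
  induction l with
  | nil => simp
  | cons x l ih =>
    rw [List.sum_cons, Submodule.coe_add, map_add, hl x (by simp),
      ih fun y hy => hl y (by simp [hy]), add_zero]

theorem tendsto_apply_weylQuad_div (r : ℕ) (l : List Q.localSA)
    (hl : ∀ x ∈ l, χ.toFun (x : 𝔐) = 0) :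
    Tendsto (fun L : ℕ => χ.toFun (weylQuad (l.map fun x : Q.localSA => localSum γ (Finset.Ico 0 (L : ℤ))
      (x : 𝔐))) / ((L + r : ℕ) : ℂ)) atTop (𝓝 (covQuad χ l)) := by
  induction l with
  | nil => simp [weylQuad, covQuad]
  | cons x l ih =>
    have hx := hl x (by simp)
    refine ((((tendsto_apply_localSum_mul_div χ r (y := x) hx).const_mul (1 / 2)).add
      (tendsto_apply_localSum_mul_div χ r (y := l.sum) hx)).add
      (ih fun y hy => hl y (by simp [hy]))).congr fun L => ?_
    rw [List.map_cons, weylQuad, sum_map_localSum, map_add, map_add, ← Complex.coe_smul, map_smul,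
      smul_eq_mul]
    push_cast
    ring

end Covariance
end

/-! ### The central limit theorem: discarding the gaps and interchanging limits. -/

noncomputable section

open Filter Topology

section Limit

/-- Interchange of limits along an approximation scheme. -/
theorem tendsto_of_approx {u : ℕ → ℂ} {v : ℕ → ℕ → ℂ} {e : ℕ → ℕ → ℝ} {e' : ℕ → ℝ} {w : ℕ → ℂ}
    {W : ℂ} (hue : ∀ L N, 0 < N → ‖u N - v L N‖ ≤ e L N)
    (he : ∀ᶠ L in atTop, Tendsto (e L) atTop (𝓝 (e' L))) (he' : Tendsto e' atTop (𝓝 0))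
    (hv : ∀ᶠ L in atTop, Tendsto (v L) atTop (𝓝 (w L))) (hw : Tendsto w atTop (𝓝 W)) :
    Tendsto u atTop (𝓝 W) := by
  rw [Metric.tendsto_nhds]
  intro ε hε
  obtain ⟨L, h1, h2, h3, h4⟩ := (he.and (hv.and ((he'.eventually_lt_const
    (show (0 : ℝ) < ε / 3 by positivity)).and
    ((Metric.tendsto_nhds.1 hw) (ε / 3) (by positivity))))).exists
  filter_upwards [h1.eventually_lt_const h3, (Metric.tendsto_nhds.1 h2) (ε / 3) (by positivity),
    eventually_gt_atTop 0] with N hN1 hN2 hN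
  have h5 := (hue L N hN).trans_lt hN1
  rw [← dist_eq_norm] at h5
  linarith [dist_triangle4 (u N) (v L N) (w L) W]

variable {𝔐 : Type*} [CStarAlgebra 𝔐] {Q : QuasiLocalAlgebra 𝔐} {γ : ShiftAction Q}
  (χ : InvMultState γ)

/-- Apart from constants, the bound depends only on `t² |S \ T|`, the density of discarded points
when `t² = 1/N`. The square root comes from the variance of the discarded sum, the linear term from
its commutators with the retained sums. -/
theorem norm_apply_weylProd_sub_le {S T : Finset ℤ} (hTS : T ⊆ S) {a : ℤ} {r : ℕ} {M t : ℝ}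
    (hM : 0 ≤ M) (l : List Q.localSA) (hl : ∀ x ∈ l, (x : 𝔐) ∈ Q.cell a (a + r))
    (h0 : ∀ x ∈ l, χ.toFun (x : 𝔐) = 0) (hlM : ∀ x ∈ l, ‖(x : 𝔐)‖ ≤ M) :
    ‖χ.toFun (weylProd (l.map fun x : Q.localSA => t • localSum γ S (x : 𝔐)))
      - χ.toFun (weylProd (l.map fun x : Q.localSA => t • localSum γ T (x : 𝔐)))‖
      ≤ l.length * (Real.sqrt (t ^ 2 * (S \ T).card * ((2 * r + 1) * M ^ 2))
        + l.length * (2 * (t ^ 2 * (S \ T).card * ((2 * r + 1) * M ^ 2)))) := by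
  have hsa : ∀ (R : Finset ℤ) (x : Q.localSA), IsSelfAdjoint (t • localSum γ R (x : 𝔐)) :=
    fun R x => (IsSelfAdjoint.all t).smul (isSelfAdjoint_localSum R x.2.1)
  have hsub : ∀ x : Q.localSA, t • localSum γ S (x : 𝔐) - t • localSum γ T (x : 𝔐)
      = t • localSum γ (S \ T) (x : 𝔐) := fun x => by
    rw [← smul_sub, localSum_sub_of_subset hTS]
  have := χ.isState.norm_weylProd_sub_le (s := {x | x ∈ l}) (N := l.length)
    (f := fun x : Q.localSA => t • localSum γ S (x : 𝔐))
    (g := fun x : Q.localSA => t • localSum γ T (x : 𝔐))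
    (δ := Real.sqrt (t ^ 2 * (S \ T).card * ((2 * r + 1) * M ^ 2)))
    (ε := 2 * (t ^ 2 * (S \ T).card * ((2 * r + 1) * M ^ 2)))
    (fun x _ => hsa S x) (fun x _ => hsa T x) (by positivity) ?_ ?_ l (fun x hx => hx) le_rfl
    (one_mem _)
  · simpa only [one_mul] using this
  · intro x hx
    rw [hsub]
    refine Real.le_sqrt_of_sq_le ?_
    rw [← Complex.coe_smul, map_smul, norm_smul, mul_pow, Complex.norm_real, Real.norm_eq_abs,
      sq_abs, mul_assoc]
    refine mul_le_mul_of_nonneg_left ?_ (sq_nonneg t)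
    refine (χ.norm_vec_localSum_sq_le _ (hl x hx) x.2.1 (h0 x hx)).trans ?_
    have := hlM x hx
    rw [sq]
    gcongr
  · intro x hx y hy
    rw [hsub]
    rw [smul_mul_smul_comm, smul_mul_smul_comm, ← smul_sub, norm_smul, Real.norm_eq_abs,
      abs_mul_self, ← sq]
    have h1 := norm_commutator_localSum_le (γ := γ) (S \ T) T (hl x hx) (hl y hy)
    have h2 := hlM x hx
    have h3 := hlM y hy
    calc t ^ 2 * _ ≤ t ^ 2 * ((S \ T).card * ((2 * r + 1) * (2 * M * M))) := by
          refine mul_le_mul_of_nonneg_left (h1.trans ?_) (sq_nonneg t)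
          gcongr
      _ = _ := by ring

theorem card_Ico_sdiff_blocks (L r N : ℕ) :
    blocks (L + r) L (N / (L + r)) ⊆ Finset.Ico (0 : ℤ) N ∧
    (((Finset.Ico (0 : ℤ) N) \ blocks (L + r) L (N / (L + r))).card : ℝ)
      = N - (N / (L + r) : ℕ) * L := by
  have hsub : blocks (L + r) L (N / (L + r)) ⊆ Finset.Ico (0 : ℤ) N := by
    -- No gap after the last block is needed here, so `blocks_subset` is used with gap width `0`.
    refine (blocks_subset (L + r) 0 L _ (by omega)).trans (Finset.Ico_subset_Ico le_rfl ?_)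
    have := Nat.div_mul_le_self N (L + r)
    push_cast at this ⊢
    have h' : (N / (L + r) * (L + r) : ℕ) ≤ N := this
    zify at h'
    simpa using h'
  refine ⟨hsub, ?_⟩
  have h := Finset.card_sdiff_add_card_eq_card hsub
  rw [card_blocks _ _ _ (by omega), Int.card_Ico] at h
  have h' : ((Finset.Ico (0 : ℤ) N) \ blocks (L + r) L (N / (L + r))).card
      + N / (L + r) * L = N := by simpa using h
  rw [eq_sub_iff_add_eq]
  exact_mod_cast h'

/-- The central limit theorem on the intervals `[0, N)`, for centred observables. -/
theorem tendsto_apply_weylProd_localSum (l : List Q.localSA)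
    (h0 : ∀ x ∈ l, χ.toFun (x : 𝔐) = 0) :
    Tendsto (fun N : ℕ => χ.toFun (weylProd (l.map fun x : Q.localSA =>
      (Real.sqrt N)⁻¹ • localSum γ (Finset.Ico 0 (N : ℤ)) (x : 𝔐)))) atTop
      (𝓝 (Complex.exp (-covQuad χ l))) := by
  obtain ⟨a, r, hl'⟩ := Q.exists_forall_mem_cell (l.map Subtype.val) (by
    intro x hx
    obtain ⟨y, -, rfl⟩ := List.mem_map.1 hx
    exact y.2.2)
  have hl : ∀ x ∈ l, (x : 𝔐) ∈ Q.cell a (a + r) := fun x hx =>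
    hl' x (List.mem_map.2 ⟨x, hx, rfl⟩)
  obtain ⟨M, hM, hlM⟩ : ∃ M : ℝ, 0 ≤ M ∧ ∀ x ∈ l, ‖(x : 𝔐)‖ ≤ M := by
    refine ⟨(l.map fun x : Q.localSA => ‖(x : 𝔐)‖).sum, List.sum_nonneg ?_, fun x hx =>
      List.single_le_sum ?_ _ (List.mem_map.2 ⟨x, hx, rfl⟩)⟩ <;>
    · intro y hy
      obtain ⟨z, -, rfl⟩ := List.mem_map.1 hy
      exact norm_nonneg _
  -- The error as a function of the density `ρ` of discarded points; only its continuity and `E 0 =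
  -- 0` matter.
  let E : ℝ → ℝ := fun ρ => l.length * (Real.sqrt (ρ * ((2 * r + 1) * M ^ 2))
        + l.length * (2 * (ρ * ((2 * r + 1) * M ^ 2))))
  have hE : Continuous E := by fun_prop
  have hE0 : E 0 = 0 := by simp [E]
  refine tendsto_of_approx
    (v := fun L N => χ.toFun (weylProd (l.map fun x : Q.localSA =>
      (Real.sqrt N)⁻¹ • localSum γ (blocks (L + r) L (N / (L + r))) (x : 𝔐))))
    -- At `L = 0` the trivial bound `2` suffices: both expectations are values of a state at
    -- unitaries, and only large `L` matters in the limit.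
    (e := fun L N => if L = 0 then 2 else E (1 - (((N / (L + r) : ℕ) : ℝ) / N) * L))
    (e' := fun L => E (1 - (1 / ((L + r : ℕ) : ℝ)) * L))
    (w := fun L => Complex.exp (-(χ.toFun (weylQuad (l.map fun x : Q.localSA =>
      localSum γ (Finset.Ico 0 (L : ℤ)) (x : 𝔐))) / ((L + r : ℕ) : ℂ)))) ?_ ?_ ?_ ?_ ?_
  · intro L N hN
    have hN' : (0 : ℝ) < N := by exact_mod_cast hN
    by_cases hL : L = 0
    · have hu : ∀ S : Finset ℤ, ‖χ.toFun (weylProd (l.map fun x : Q.localSA =>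
          (Real.sqrt N)⁻¹ • localSum γ S (x : 𝔐)))‖ ≤ 1 := by
        intro S
        refine (χ.isState.norm_apply_le _).trans ?_
        rw [← mul_one (weylProd _), χ.isState.norm_vec_mul_of_unitary, χ.isState.norm_vec_one]
        refine (Unitary.mem_iff.1 (weylProd_mem_unitary fun b hb => ?_)).1
        obtain ⟨x, -, rfl⟩ := List.mem_map.1 hb
        exact (IsSelfAdjoint.all _).smul (isSelfAdjoint_localSum S x.2.1)
      rw [if_pos hL]
      refine (norm_sub_le _ _).trans ?_
      linarith [hu (Finset.Ico 0 (N : ℤ)), hu (blocks (L + r) L (N / (L + r)))]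
    · obtain ⟨hsub, hcard⟩ := card_Ico_sdiff_blocks L r N
      rw [if_neg hL]
      refine (norm_apply_weylProd_sub_le χ hsub hM l hl h0 hlM).trans_eq ?_
      have e : (Real.sqrt N)⁻¹ ^ 2
          * ((Finset.Ico (0 : ℤ) N) \ blocks (L + r) L (N / (L + r))).card
          = 1 - (((N / (L + r) : ℕ) : ℝ) / N) * L := by
        rw [hcard, inv_pow, Real.sq_sqrt hN'.le]
        field_simp
      rw [e]
  · filter_upwards [eventually_gt_atTop 0] with L hL
    simp only [if_neg hL.ne']
    exact (hE.tendsto _).comp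
      (((tendsto_nat_div_div (L + r) (by omega)).mul_const (L : ℝ)).const_sub 1)
  -- The limiting density of the gaps is `r / (L + r)`, which vanishes for long blocks.
  · have h1 : Tendsto (fun L : ℕ => 1 - (1 / ((L + r : ℕ) : ℝ)) * L) atTop (𝓝 (1 - 1)) := by
      refine Tendsto.const_sub 1 ?_
      refine (tendsto_natCast_div_add_atTop (𝕜 := ℝ) (r : ℝ)).congr fun L => ?_
      push_cast
      rw [one_div_mul_eq_div]
    rw [sub_self] at h1
    have := (hE.tendsto 0).comp h1
    rwa [hE0] at this
  · filter_upwards [eventually_gt_atTop 0] with L hL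
    have hz := χ.isState.apply_weylProd_smul_isLittleO
      (l.map fun x : Q.localSA => localSum γ (Finset.Ico 0 (L : ℤ)) (x : 𝔐)) (by
        rw [sum_map_localSum]
        exact apply_localSum χ _ (apply_list_sum_eq_zero χ h0))
    refine (tendsto_pow_nat_div_exp hz (L + r) (by omega)).congr fun N => ?_
    have h2 := χ.apply_weylProd_localSum_blocks r L (N / (L + r)) (Real.sqrt N)⁻¹
      (l.map Subtype.val) hl'
    simp only [List.map_map, Function.comp_def] at h2 ⊢
    exact h2.symm
  · exact (Complex.continuous_exp.tendsto _).comp (tendsto_apply_weylQuad_div χ r l h0).neg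

theorem FinInterval.exists_eq_image_add (I : FinInterval) :
    ∃ c : ℤ, I.1 = (Finset.Ico (0 : ℤ) I.1.card).image fun j => j + c := by
  rcases I.1.eq_empty_or_nonempty with h | h
  · exact ⟨0, by simp [h]⟩
  · have e : I.1 = Finset.Icc (I.1.min' h) (I.1.max' h) := by
      ext k
      rw [Finset.mem_Icc]
      refine ⟨fun hk => ⟨Finset.min'_le _ _ hk, Finset.le_max' _ _ hk⟩, fun hk => ?_⟩
      exact I.2.out (I.1.min'_mem h) (I.1.max'_mem h) hk
    have hle := I.1.min'_le _ (I.1.max'_mem h)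
    refine ⟨I.1.min' h, ?_⟩
    have hcard : (I.1.card : ℤ) = I.1.max' h + 1 - I.1.min' h := by
      conv_lhs => rw [e, Int.card_Icc]
      omega
    rw [Finset.image_add_right_Ico, hcard]
    conv_lhs => rw [e]
    ext k
    simp only [Finset.mem_Icc, Finset.mem_Ico]
    omega

theorem FinInterval.tendsto_card {I : ℕ → FinInterval} (hI : Monotone I)
    (hI_exhaust : ∀ j : ℤ, ∃ n, j ∈ (I n).1) :
    Tendsto (fun n => (I n).1.card) atTop atTop := by
  refine tendsto_atTop_atTop_of_monotone (fun m n h => Finset.card_le_card (hI h)) fun N => ?_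
  have h : ∀ S : Finset ℤ, ∃ n, S ⊆ (I n).1 := by
    intro S
    induction S using Finset.induction with
    | empty => exact ⟨0, Finset.empty_subset _⟩
    | insert j S _ ih =>
      obtain ⟨m, hm⟩ := ih
      obtain ⟨n, hn⟩ := hI_exhaust j
      exact ⟨max m n, Finset.insert_subset (hI (le_max_right m n) hn)
        (hm.trans (hI (le_max_left m n)))⟩
  obtain ⟨n, hn⟩ := h (Finset.Ico (0 : ℤ) N)
  exact ⟨n, by simpa using Finset.card_le_card hn⟩

/-- Each `I n` is a translate of `[0, |I n|)`, so by invariance only its cardinality matters, and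
this tends to infinity. Centring the observables leaves `covQuad` unchanged. -/
theorem tendsto_apply_weylProd_fluctuation {I : ℕ → FinInterval} (hI : Monotone I)
    (hI_exhaust : ∀ j : ℤ, ∃ n, j ∈ (I n).1) (l : List Q.localSA) :
    Tendsto (fun n => χ.toFun (weylProd (l.map fun x : Q.localSA =>
      fluctuation χ (I n) (x : 𝔐)))) atTop (𝓝 (Complex.exp (-covQuad χ l))) := by
  have h := (tendsto_apply_weylProd_localSum χ (l.map (center χ)) (by
    intro x hx
    obtain ⟨y, -, rfl⟩ := List.mem_map.1 hx
    exact apply_center χ y)).comp (FinInterval.tendsto_card hI hI_exhaust)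
  rw [covQuad_map_center] at h
  refine h.congr fun n => ?_
  obtain ⟨c, hc⟩ := (I n).exists_eq_image_add
  have := χ.apply_weylProd_localSum_image_add (Finset.Ico (0 : ℤ) (I n).1.card) c
    (Real.sqrt (I n).1.card)⁻¹ (l.map fun x => (center χ x : 𝔐))
  rw [← hc] at this
  simp only [List.map_map, Function.comp_def, fluctuation_eq] at this ⊢
  exact this.symm

end Limit

/-! ### The quasi-free state: positivity as a consequence of the limit theorem. -/

section QuasiFree

variable {𝔐 : Type*} [CStarAlgebra 𝔐] {Q : QuasiLocalAlgebra 𝔐} {γ : ShiftAction Q}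
  (χ : InvMultState γ)

/-- The quasi-free functional on the Weyl `*`-algebra. -/
def quasiFree : WeylPoly (sigmaForm χ) →ₗ[ℂ] ℂ :=
  (WeylPoly.basis (sigmaForm χ)).constr ℂ fun x => (Real.exp (-(sForm χ x x) / 2) : ℂ)

theorem quasiFree_gen (x : Q.localSA) :
    quasiFree χ (WeylPoly.gen _ x) = (Real.exp (-(sForm χ x x) / 2) : ℂ) :=
  Module.Basis.constr_basis _ _ _ _

theorem fluctuation_neg (I : FinInterval) (x : 𝔐) :
    fluctuation χ I (-x) = -fluctuation χ I x := by
  rw [fluctuation, fluctuation, ← smul_neg, ← Finset.sum_neg_distrib]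
  congr 1
  refine Finset.sum_congr rfl fun j _ => ?_
  rw [map_neg, map_neg, neg_smul]
  abel

theorem isSelfAdjoint_fluctuation (I : FinInterval) (x : Q.localSA) :
    IsSelfAdjoint (fluctuation χ I (x : 𝔐)) := by
  rw [fluctuation_eq]
  exact (IsSelfAdjoint.all _).smul (isSelfAdjoint_localSum _ (center χ x).2.1)

/-- The approximate representation `w(x) ↦ e^{i F_I(x)}` of the Weyl `*`-algebra. -/
def approxRep (I : FinInterval) : WeylPoly (sigmaForm χ) →ₗ[ℂ] 𝔐 :=
  (WeylPoly.basis (sigmaForm χ)).constr ℂ fun x : Q.localSA =>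
    NormedSpace.exp (Complex.I • fluctuation χ I (x : 𝔐))

theorem approxRep_gen (I : FinInterval) (x : Q.localSA) :
    approxRep χ I (WeylPoly.gen _ x) = NormedSpace.exp (Complex.I • fluctuation χ I (x : 𝔐)) :=
  Module.Basis.constr_basis _ _ _ _

theorem star_exp_fluctuation (I : FinInterval) (x : Q.localSA) :
    star (NormedSpace.exp (Complex.I • fluctuation χ I (x : 𝔐)))
      = NormedSpace.exp (Complex.I • fluctuation χ I ((-x : Q.localSA) : 𝔐)) := by
  rw [NormedSpace.star_exp, star_smul, (isSelfAdjoint_fluctuation χ I x).star_eq,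
    Submodule.coe_neg, fluctuation_neg, Complex.star_def, Complex.conj_I, neg_smul, smul_neg]

/-- Both sides are sesquilinear in `(f, g)`, so it is enough to treat generators. There the claim is
the limit theorem for the list `[-x, y]`. -/
theorem tendsto_apply_star_approxRep_mul {I : ℕ → FinInterval} (hI : Monotone I)
    (hI_exhaust : ∀ j : ℤ, ∃ n, j ∈ (I n).1) (f g : WeylPoly (sigmaForm χ)) :
    Tendsto (fun n => χ.toFun (star (approxRep χ (I n) f) * approxRep χ (I n) g)) atTop
      (𝓝 (quasiFree χ (star f * g))) := by
  induction f using WeylPoly.induction with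
  | zero => simp
  | add f f' hf hf' =>
    simp only [map_add, star_add, add_mul]
    exact hf.add hf'
  | smul_gen c x =>
  induction g using WeylPoly.induction with
  | zero => simp
  | add g g' hg hg' =>
    simp only [map_add, mul_add]
    exact hg.add hg'
  | smul_gen d y =>
    simp only [map_smul, star_smul, smul_mul_assoc, mul_smul_comm]
    refine (Tendsto.const_smul ?_ _).const_smul _
    have h := tendsto_apply_weylProd_fluctuation χ hI hI_exhaust [-x, y]
    rw [← apply_prod_gen χ (quasiFree_gen χ)] at h
    rw [WeylPoly.star_gen]
    simp only [List.map_cons, List.map_nil, List.prod_cons, List.prod_nil, mul_one,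
      weylProd_cons, weylProd_nil] at h
    refine h.congr fun n => ?_
    rw [approxRep_gen, approxRep_gen, star_exp_fluctuation]

open scoped ComplexOrder in
-- Positivity is inherited from `χ`: the value at `f* f` is a limit of numbers `χ(A* A)`. The maps
-- `approxRep` need not be multiplicative for this, and no separate proof that the Gaussian kernel
-- is positive definite is required.
theorem isState_quasiFree {I : ℕ → FinInterval} (hI : Monotone I)
    (hI_exhaust : ∀ j : ℤ, ∃ n, j ∈ (I n).1) : IsState (quasiFree χ) where
  map_one := by
    rw [WeylPoly.one_def, quasiFree_gen, sForm_eq_re_cov, cov_zero_left]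
    simp
  nonneg f := ge_of_tendsto' (tendsto_apply_star_approxRep_mul χ hI hI_exhaust f f)
    fun _ => χ.isState.nonneg _

theorem IsQuasiFreeState.apply_prod_w {φ : WeylAlgebra (sigmaForm χ) →ₗ[ℂ] ℂ}
    (h : IsQuasiFreeState (sForm χ) φ) (l : List Q.localSA) :
    φ (l.map (WeylAlgebra.w (sigmaForm χ))).prod = Complex.exp (-covQuad χ l) := by
  have e : (l.map (WeylAlgebra.w (sigmaForm χ))).prod
      = WeylAlgebra.ofₗ (sigmaForm χ) (l.map (WeylPoly.gen (sigmaForm χ))).prod := by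
    induction l with
    | nil => exact WeylAlgebra.of_one.symm
    | cons x l ih =>
      rw [List.map_cons, List.prod_cons, ih, List.map_cons, List.prod_cons]
      exact (WeylAlgebra.of_mul _ _).symm
  rw [e]
  exact apply_prod_gen χ (φ := φ ∘ₗ WeylAlgebra.ofₗ (sigmaForm χ)) h.map_w l

end QuasiFree

end

theorem theorem4p1 {𝔐 : Type*} [CStarAlgebra 𝔐] (Q : QuasiLocalAlgebra 𝔐) (γ : ShiftAction Q)
    (χ : InvMultState γ) (I : ℕ → FinInterval) (hI : Monotone I)
    (hI_exhaust : ∀ j : ℤ, ∃ n, j ∈ (I n).1) :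
    (∃! φ : WeylAlgebra (sigmaForm χ) →ₗ[ℂ] ℂ, IsQuasiFreeState (sForm χ) φ) ∧
    ∀ φ : WeylAlgebra (sigmaForm χ) →ₗ[ℂ] ℂ, IsQuasiFreeState (sForm χ) φ →
      ∀ (k : ℕ) (x : Fin k → Q.localSA),
        Filter.Tendsto
          (fun n : ℕ => χ.toFun (List.ofFn fun i : Fin k =>
            NormedSpace.exp (Complex.I • fluctuation χ (I n) (x i : 𝔐))).prod)
          Filter.atTop
          (nhds (φ (List.ofFn fun i : Fin k => WeylAlgebra.w (sigmaForm χ) (x i)).prod)) := by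
  refine ⟨?_, fun φ hφ k x => ?_⟩
  · obtain ⟨φ, hφ, hφof⟩ :=
      WeylAlgebra.exists_state_extension (isState_quasiFree χ hI hI_exhaust)
    refine ⟨φ, ⟨hφ, fun x => (hφof _).trans (quasiFree_gen χ x)⟩, fun ψ hψ => ?_⟩
    exact WeylAlgebra.state_ext hψ.isState hφ fun x =>
      (hψ.map_w x).trans ((hφof _).trans (quasiFree_gen χ x)).symm
  · have h := tendsto_apply_weylProd_fluctuation χ hI hI_exhaust (List.ofFn x)
    rw [← hφ.apply_prod_w χ] at h
    simpa only [weylProd, List.map_map, List.map_ofFn, Function.comp_def] using h
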